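/- Let $d\ge 2$, let $S^d=\{x\in\mathbb R^{d+1} : \|x\|=1\}$, let $e_1=(1,0,\dots,0)$, and let $\sigma$ be the rotation-invariant probability measure on $S^d$. For integers $n\ge 0$ put $$d(n)=(2n+d-1)\frac{(d+n-2)!}{(d-1)!\,n!},\qquad \Phi_n(t)={}_2F_1\!\left(n+d-1,-n;\tfrac d2;\tfrac{1-t}{2}\right),$$ and for integers $\Omega\ge 0$ put $$F_{\phi_\Omega}(t)=\sum_{n=0}^{\Omega}d(n)\,\Phi_n(t),\qquad \phi_\Omega(x)=F_{\phi_\Omega}((x,e_1))\quad(x\in S^d).$$ Let $L^2_\Omega(S^d)$ be the complex vector space of restrictions to $S^d$ of harmonic polynomials on $\mathbb R^{d+1}$ (with complex coefficients) of degree at most $\Omega$. For functions $f,g$ on $S^d=\mathrm{SO}(d+1)/\mathrm{SO}(d)$ let $$(f*g)(y)=\int_{\mathrm{SO}(d+1)}f(a e_1)\,g(a^{-1}y)\,da\quad(y\in S^d),$$ where $da$ is the Haar probability measure. Then: 1. $\phi_\Omega(e_1)=\sum_{n=0}^{\Omega}d(n)=\dim L^2_\Omega(S^d)$ for every $\Omega$,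 and this quantity is strictly increasing in $\Omega$ and tends to $\infty$ as $\Omega\to\infty$. 2. $\int_{S^d}\phi_\Omega\,d\sigma=1$ for every $\Omega$. 3. $\|\phi_\Omega\|_{L^2(S^d,\sigma)}^2=\sum_{n=0}^{\Omega}d(n)$ for every $\Omega$, and this tends to $\infty$ as $\Omega\to\infty$. 4. If $f\in L^2(S^d,\sigma)$ (complex-valued), then for every $\Omega$ and every $y\in S^d$ $$(f*\phi_\Omega)(y)=\int_{S^d}f(x)\,F_{\phi_\Omega}((y,x))\,d\sigma(x),$$ where both integrals converge absolutely; moreover $f*\phi_\Omega\in L^2(S^d,\sigma)$ and $f*\phi_\Omega\to f$ in $L^2(S^d,\sigma)$ as $\Omega\to\infty$. -/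

import Mathlib

open MeasureTheory Filter Topology
open scoped Nat ENNReal

noncomputable section

namespace SphereKernel

/-! ### The sphere and its normalized rotation-invariant measure -/

/-- The unit sphere `S^d` in `ℝ^{d+1}` with the Euclidean norm. -/
abbrev Sph (d : ℕ) : Type := Metric.sphere (0 : EuclideanSpace ℝ (Fin (d + 1))) 1

/-- The base point `e₁ = (1, 0, …, 0)`. -/
def e1 (d : ℕ) : Sph d :=
  ⟨EuclideanSpace.single 0 1, by simp⟩

/-- The surface measure on `S^d`, normalized to have total mass one. -/
def sigma (d : ℕ) : Measure (Sph d) :=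
  ((volume : Measure (EuclideanSpace ℝ (Fin (d + 1)))).toSphere Set.univ)⁻¹ •
    (volume : Measure (EuclideanSpace ℝ (Fin (d + 1)))).toSphere

/-! ### Harmonic polynomials and the Paley-Wiener space -/

/-- The Laplace operator `∑ i, ∂²/∂xᵢ²` on complex polynomials in `d + 1` variables. -/
def polyLaplacian (d : ℕ) :
    MvPolynomial (Fin (d + 1)) ℂ →ₗ[ℂ] MvPolynomial (Fin (d + 1)) ℂ :=
  ∑ i, (MvPolynomial.pderiv i).toLinearMap ∘ₗ (MvPolynomial.pderiv i).toLinearMap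

/-- Restriction of a polynomial on `ℝ^{d+1}` to a function on the sphere. -/
def restrictSphere (d : ℕ) : MvPolynomial (Fin (d + 1)) ℂ →ₗ[ℂ] (Sph d → ℂ) where
  toFun p x := MvPolynomial.eval (fun i => ((x.1 i : ℝ) : ℂ)) p
  map_add' p q := by ext x; simp
  map_smul' c p := by ext x; simp [MvPolynomial.smul_eval]

/-- `L²_Ω(S^d)`: the restrictions to the sphere of the harmonic polynomials of degree at most
`Ω`. -/
def paleyWiener (d Ω : ℕ) : Submodule ℂ (Sph d → ℂ) :=
  (LinearMap.ker (polyLaplacian d) ⊓ MvPolynomial.restrictTotalDegree (Fin (d + 1)) ℂ Ω).map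
    (restrictSphere d)

/-! ### The kernel -/

/-- `d(n) = (2n+d-1) (d+n-2)! / ((d-1)! n!)`, meant for `2 ≤ d`. -/
def dimY (d n : ℕ) : ℝ :=
  (2 * (n : ℝ) + (d : ℝ) - 1) * ((d + n - 2)! : ℝ) / (((d - 1)! : ℝ) * (n ! : ℝ))

/-- `Φ_n(t) = ₂F₁(n+d-1, -n; d/2; (1-t)/2)`, the normalized Gegenbauer polynomial (the series
terminates). -/
def Phi (d n : ℕ) (t : ℝ) : ℝ :=
  ordinaryHypergeometric ((n : ℝ) + (d : ℝ) - 1) (-(n : ℝ)) ((d : ℝ) / 2) ((1 - t) / 2)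

/-- `F_{φ_Ω}(t) = ∑_{n ≤ Ω} d(n) Φ_n(t)`. -/
def kernelProfile (d Ω : ℕ) (t : ℝ) : ℝ :=
  ∑ n ∈ Finset.range (Ω + 1), dimY d n * Phi d n t

/-- `φ_Ω(x) = F_{φ_Ω}((x, e₁))`. -/
def phi (d Ω : ℕ) (x : Sph d) : ℝ :=
  kernelProfile d Ω (inner ℝ x.1 (e1 d).1)

/-! ### The rotation group and convolution on `S^d = SO(d+1)/SO(d)` -/

/-- The rotation group `SO(d+1)`, with the topology inherited from matrices. -/
abbrev Rot (d : ℕ) : Type := Matrix.specialOrthogonalGroup (Fin (d + 1)) ℝ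

instance (d : ℕ) : IsTopologicalGroup (Rot d) where
  continuous_inv := by
    refine Continuous.subtype_mk (f := fun a : Rot d => star a.1) ?_ _
    exact continuous_subtype_val.star

instance (d : ℕ) : CompactSpace (Rot d) := by
  refine isCompact_iff_compactSpace.mp ?_
  have hK : IsCompact (Set.pi Set.univ (fun _ : Fin (d + 1) =>
      Set.pi Set.univ (fun _ : Fin (d + 1) => Set.Icc (-1 : ℝ) 1))) :=
    isCompact_univ_pi fun _ => isCompact_univ_pi fun _ => isCompact_Icc
  refine IsCompact.of_isClosed_subset hK ?_ ?_
  · have h : (Matrix.specialOrthogonalGroup (Fin (d + 1)) ℝ :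
          Set (Matrix (Fin (d + 1)) (Fin (d + 1)) ℝ)) =
        {A | A * star A = 1} ∩ {A | Matrix.det A = 1} := by
      ext A
      exact Matrix.mem_specialOrthogonalGroup_iff.trans
        (and_congr_left fun _ => Matrix.mem_orthogonalGroup_iff _ _)
    rw [h]
    exact (isClosed_eq (by fun_prop) (by fun_prop)).inter
      (isClosed_eq (by fun_prop) (by fun_prop))
  · intro A hA i _ j _
    have h := entry_norm_bound_of_unitary (Matrix.mem_specialUnitaryGroup_iff.mp hA).1 i j
    exact abs_le.mp h

/-- The Borel σ-algebra of `SO(d+1)`. -/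
instance (d : ℕ) : MeasurableSpace (Rot d) := borel (Rot d)

instance (d : ℕ) : BorelSpace (Rot d) := ⟨rfl⟩

/-- The Haar measure of `SO(d+1)` with total mass one. -/
def haarRot (d : ℕ) : Measure (Rot d) := Measure.haarMeasure ⊤

/-- The action of a rotation on a point of the sphere: the matrix-vector product. -/
def rotate {d : ℕ} (a : Rot d) (x : Sph d) : Sph d :=
  ⟨WithLp.toLp 2 (a.1.mulVec x.1.ofLp), by
    have ha : a.1.transpose * a.1 = 1 :=
      (Matrix.mem_orthogonalGroup_iff' _ _).mp (Matrix.mem_specialOrthogonalGroup_iff.mp a.2).1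
    have hx : ‖x.1‖ = 1 := by simp
    have key : ‖WithLp.toLp 2 (a.1.mulVec x.1.ofLp)‖ ^ 2 = ‖x.1‖ ^ 2 := by
      have hv : ∀ v : EuclideanSpace ℝ (Fin (d + 1)), ‖v‖ ^ 2 = v.ofLp ⬝ᵥ v.ofLp := fun v => by
        rw [EuclideanSpace.real_norm_sq_eq]; simp [dotProduct, sq]
      rw [hv, hv]
      change (a.1.mulVec x.1.ofLp) ⬝ᵥ (a.1.mulVec x.1.ofLp) = _
      rw [Matrix.dotProduct_mulVec, ← Matrix.mulVec_transpose, Matrix.mulVec_mulVec, ha,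
        Matrix.one_mulVec]
    rw [hx] at key
    rw [mem_sphere_zero_iff_norm]
    nlinarith [norm_nonneg (WithLp.toLp 2 (a.1.mulVec x.1.ofLp))]⟩

/-- Convolution of functions on `S^d = G/K`, `G = SO(d+1)`: identifying `f` with the function
`a ↦ f (a e₁)` on `G`, it is `(f * g)(b e₁) = ∫_G f(a e₁) g(a⁻¹ b e₁) da`. -/
def conv {d : ℕ} (f g : Sph d → ℂ) (x : Sph d) : ℂ :=
  ∫ a : Rot d, f (rotate a (e1 d)) * g (rotate a⁻¹ x) ∂(haarRot d)

end SphereKernel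

end

open SphereKernel

/-!
Everything rests on the reproducing property `∫ p(x) K_Ω(x, y) dσ(x) = p(y)`, where
`K_Ω(x, y) = F_{φ_Ω}((x, y))`, for all polynomials `p` of degree at most `Ω`
(`IsSpherical.map_kernelPoly_mul`, `integral_kernel_mul`).

The proof of that property is algebraic. Integration over the sphere is a linear functional `I` on
polynomials that ignores a factor `∑ xᵢ²` and kills every `(xᵢ ∂ⱼ - xⱼ ∂ᵢ) p`; the latter is
invariance under rotations, differentiated (`isSpherical_sphereIntegral`). These two facts give
integration by parts on the sphere (`IsSpherical.pderiv`). With `s = (1 - (x, y)) / 2` and `h`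
harmonic and homogeneous of degree `m`, two integrations by parts yield the recursion
`(k (k+d-1) - m (m+d-1)) I(sᵏ h) = k (k-1+d/2) I(sᵏ⁻¹ h)` (`IsSpherical.moment_succ`). So the
moments vanish for `k < m`, and the one with `k = m` is an explicit multiple of `h(y)`
(`IsSpherical.moment_self`). The hypergeometric recursion for the coefficients of `Φ_n` is the
adjoint recursion for the eigenvalue `n (n+d-1)`; hence `I(Φ_n h) = 0` for `n ≠ m`, and for `n = m`
only the top coefficient contributes, giving `h(y) / d(m)`. Finally, modulo `∑ xᵢ² - 1` every
polynomial is a sum of homogeneous harmonic polynomials of no larger degree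
(`restrictTotalDegree_le_of_harmonic`).

The reproducing property makes `∫ p q dσ` nondegenerate on the Paley-Wiener space, with
`K_Ω(y, x) = ∑ bᵢ(y) cᵢ(x)` for a basis and its dual basis (`exists_kernel_eq_sum`). Integrating
over the diagonal shows that the dimension is `K_Ω(y, y) = ∑ d(n)`, and the integral and the norm of
`φ_Ω` are the reproducing property for `1` and for `φ_Ω`. The orbit map `a ↦ a e₁` carries the Haar
measure to `σ` (`measurePreserving_orbit`), so convolution with `φ_Ω` is the integral operator with
kernel `K_Ω`; this operator is the orthogonal projection to the Paley-Wiener space, and it converges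
strongly to the identity because polynomials are dense (Stone-Weierstrass).
-/

namespace SphereKernel

open MvPolynomial

variable {d : ℕ} {I : MvPolynomial (Fin (d + 1)) ℂ →ₗ[ℂ] ℂ}

/-! ### Differential operators on polynomials -/

/-- The Euler operator `∑ i, xᵢ ∂/∂xᵢ`, which multiplies homogeneous polynomials by their degree. -/
noncomputable def eulerOp (d : ℕ) :
    Derivation ℂ (MvPolynomial (Fin (d + 1)) ℂ) (MvPolynomial (Fin (d + 1)) ℂ) :=
  ∑ i, (X i : MvPolynomial (Fin (d + 1)) ℂ) • pderiv i

/-- The derivative `∑ i, yᵢ ∂/∂xᵢ` in the direction of the constant vector `y`. -/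
noncomputable def dirDeriv {d : ℕ} (y : Fin (d + 1) → ℂ) :
    Derivation ℂ (MvPolynomial (Fin (d + 1)) ℂ) (MvPolynomial (Fin (d + 1)) ℂ) :=
  ∑ i, y i • pderiv i

/-- The polynomial `∑ i, xᵢ²`. -/
noncomputable def sqNorm (d : ℕ) : MvPolynomial (Fin (d + 1)) ℂ := ∑ i, X i ^ 2

/-- The polynomial `x ↦ (1 - (x, y)) / 2`, the argument of the hypergeometric function in the
kernel with pole `y`. -/
noncomputable def poleVar {d : ℕ} (y : Fin (d + 1) → ℂ) : MvPolynomial (Fin (d + 1)) ℂ :=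
  C (1 / 2) * (1 - ∑ i, C (y i) * X i)

theorem eulerOp_apply (p : MvPolynomial (Fin (d + 1)) ℂ) :
    eulerOp d p = ∑ i, X i * pderiv i p := by
  simp only [eulerOp]
  rw [← Derivation.coeFnAddMonoidHom_apply, map_sum, Finset.sum_apply]
  simp

theorem dirDeriv_apply (y : Fin (d + 1) → ℂ) (p : MvPolynomial (Fin (d + 1)) ℂ) :
    dirDeriv y p = ∑ i, C (y i) * pderiv i p := by
  simp only [dirDeriv]
  rw [← Derivation.coeFnAddMonoidHom_apply, map_sum, Finset.sum_apply]
  simp [MvPolynomial.smul_eq_C_mul]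

theorem polyLaplacian_apply (p : MvPolynomial (Fin (d + 1)) ℂ) :
    polyLaplacian d p = ∑ i, pderiv i (pderiv i p) := by
  simp [polyLaplacian]

theorem pderiv_comm (i j : Fin (d + 1)) (p : MvPolynomial (Fin (d + 1)) ℂ) :
    pderiv i (pderiv j p) = pderiv j (pderiv i p) := by
  have h : ⁅(pderiv i : Derivation ℂ (MvPolynomial (Fin (d + 1)) ℂ) _),
      (pderiv j : Derivation ℂ (MvPolynomial (Fin (d + 1)) ℂ) _)⁆ = 0 := by
    refine MvPolynomial.derivation_ext fun k => ?_
    rw [Derivation.commutator_apply, pderiv_X, pderiv_X]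
    simp only [Pi.single_apply]
    split_ifs <;> simp
  have := congrArg (fun D => D p) h
  simpa [Derivation.commutator_apply, sub_eq_zero] using this

theorem polyLaplacian_pderiv (i : Fin (d + 1)) (p : MvPolynomial (Fin (d + 1)) ℂ) :
    polyLaplacian d (pderiv i p) = pderiv i (polyLaplacian d p) := by
  simp only [polyLaplacian_apply, map_sum]
  exact Finset.sum_congr rfl fun j _ => by rw [pderiv_comm j i, pderiv_comm j i]

theorem polyLaplacian_dirDeriv (y : Fin (d + 1) → ℂ) {p : MvPolynomial (Fin (d + 1)) ℂ}
    (hp : polyLaplacian d p = 0) : polyLaplacian d (dirDeriv y p) = 0 := by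
  simp [dirDeriv_apply, ← MvPolynomial.smul_eq_C_mul, polyLaplacian_pderiv, hp]

theorem isHomogeneous_dirDeriv {m : ℕ} {p : MvPolynomial (Fin (d + 1)) ℂ}
    (hp : p.IsHomogeneous m) (y : Fin (d + 1) → ℂ) :
    (dirDeriv y p).IsHomogeneous (m - 1) := by
  rw [dirDeriv_apply]
  exact MvPolynomial.IsHomogeneous.sum _ _ _ fun i _ => hp.pderiv.C_mul _

theorem eulerOp_of_isHomogeneous {m : ℕ} {p : MvPolynomial (Fin (d + 1)) ℂ}
    (hp : p.IsHomogeneous m) : eulerOp d p = C (m : ℂ) * p := by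
  rw [eulerOp_apply, hp.sum_X_mul_pderiv]
  simp

theorem eulerOp_pderiv (i : Fin (d + 1)) (p : MvPolynomial (Fin (d + 1)) ℂ) :
    eulerOp d (pderiv i p) = pderiv i (eulerOp d p) - pderiv i p := by
  simp only [eulerOp_apply, map_sum, pderiv_mul, Finset.sum_add_distrib, pderiv_comm i]
  simp [pderiv_X, Pi.single_apply]

/-- Euler's identity at the pole: for `p` homogeneous of degree `m`, differentiating in the
direction `y` and evaluating at `y` multiplies the value by `m`. -/
theorem eval_dirDeriv_self {m : ℕ} {p : MvPolynomial (Fin (d + 1)) ℂ}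
    (hp : p.IsHomogeneous m) (y : Fin (d + 1) → ℂ) :
    eval y (dirDeriv y p) = m * eval y p := by
  have := congrArg (eval y) (eulerOp_of_isHomogeneous hp)
  simpa [eulerOp_apply, dirDeriv_apply] using this

theorem pderiv_poleVar (y : Fin (d + 1) → ℂ) (i : Fin (d + 1)) :
    pderiv i (poleVar y) = C (-(y i / 2)) := by
  simp only [poleVar, pderiv_C_mul, map_sub, map_sum, pderiv_one, pderiv_X, Pi.single_apply]
  simp [div_eq_mul_inv, mul_comm]

theorem eulerOp_poleVar (y : Fin (d + 1) → ℂ) :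
    eulerOp d (poleVar y) = poleVar y - C (1 / 2) := by
  simp only [eulerOp_apply, pderiv_poleVar]
  rw [poleVar]
  simp only [map_neg, div_eq_mul_inv, map_mul, mul_sub, Finset.mul_sum, one_mul, mul_one]
  rw [sub_sub_cancel_left, ← Finset.sum_neg_distrib]
  exact Finset.sum_congr rfl fun i _ => by ring

theorem dirDeriv_poleVar {y : Fin (d + 1) → ℂ} (hy : ∑ i, y i ^ 2 = 1) :
    dirDeriv y (poleVar y) = C (-(1 / 2)) := by
  simp only [dirDeriv_apply, pderiv_poleVar, ← map_mul, ← map_sum]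
  rw [← hy, Finset.sum_div, ← Finset.sum_neg_distrib]
  exact congrArg C (Finset.sum_congr rfl fun i _ => by ring)

theorem sum_C_mul_X_eq (y : Fin (d + 1) → ℂ) :
    ∑ i, C (y i) * X i = (1 - C 2 * poleVar y : MvPolynomial (Fin (d + 1)) ℂ) := by
  rw [poleVar, ← mul_assoc, ← map_mul]
  norm_num

/-! ### Integration by parts for rotation-invariant functionals -/

/-- A linear functional on polynomials that behaves like integration over the unit sphere: it kills
the image of the infinitesimal rotations `xᵢ ∂ⱼ - xⱼ ∂ᵢ` and does not see the factor `∑ xᵢ²`. -/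
structure IsSpherical (I : MvPolynomial (Fin (d + 1)) ℂ →ₗ[ℂ] ℂ) : Prop where
  rot : ∀ i j p, I (X i * pderiv j p) = I (X j * pderiv i p)
  sqNorm_mul : ∀ p, I (sqNorm d * p) = I p

theorem map_C_mul_apply (I : MvPolynomial (Fin (d + 1)) ℂ →ₗ[ℂ] ℂ) (c : ℂ)
    (p : MvPolynomial (Fin (d + 1)) ℂ) : I (C c * p) = c * I p := by
  rw [← MvPolynomial.smul_eq_C_mul, map_smul, smul_eq_mul]

/-- The divergence theorem on the sphere, obtained by summing the infinitesimal rotation identity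
for `xⱼ q` over `j`. -/
theorem IsSpherical.pderiv (hI : IsSpherical I) (i : Fin (d + 1))
    (q : MvPolynomial (Fin (d + 1)) ℂ) :
    I (pderiv i q) = I (X i * (eulerOp d q + C (d : ℂ) * q)) := by
  have h : I (∑ j, X i * MvPolynomial.pderiv j (X j * q)) =
      I (∑ j, X j * MvPolynomial.pderiv i (X j * q)) := by
    simp only [map_sum]
    exact Finset.sum_congr rfl fun j _ => hI.rot i j _
  have h1 : ∑ j, X i * MvPolynomial.pderiv j (X j * q) =
      X i * (eulerOp d q + C (d : ℂ) * q) + X i * q := by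
    simp only [pderiv_mul, pderiv_X_self, one_mul, ← Finset.mul_sum, Finset.sum_add_distrib,
      ← eulerOp_apply, Finset.sum_const, Finset.card_univ, Fintype.card_fin, nsmul_eq_mul]
    simp only [Nat.cast_add, map_natCast, Nat.cast_one]
    ring
  have h2 : ∑ j, X j * MvPolynomial.pderiv i (X j * q) =
      sqNorm d * MvPolynomial.pderiv i q + X i * q := by
    simp only [pderiv_mul, mul_add, Finset.sum_add_distrib, sqNorm, Finset.sum_mul]
    refine (add_comm _ _).trans ?_
    congr 1
    · exact Finset.sum_congr rfl fun j _ => by ring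
    · simp [pderiv_X, Pi.single_apply]
  rw [h1, h2, map_add, map_add, hI.sqNorm_mul] at h
  exact (add_right_cancel h).symm

theorem IsSpherical.dirDeriv (hI : IsSpherical I) (y : Fin (d + 1) → ℂ)
    (q : MvPolynomial (Fin (d + 1)) ℂ) :
    I (dirDeriv y q) =
      I ((1 - C 2 * poleVar y) * (eulerOp d q + C (d : ℂ) * q)) := by
  rw [← sum_C_mul_X_eq, dirDeriv_apply, Finset.sum_mul]
  simp only [map_sum, mul_assoc, map_C_mul_apply, hI.pderiv]

/-- Integration by parts in the direction of the pole, for `q = sᵏ h` with `s = (1 - (x, y)) / 2`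
and `h` homogeneous. -/
theorem IsSpherical.poleVar_pow_mul_dirDeriv (hI : IsSpherical I) {y : Fin (d + 1) → ℂ}
    (hy : ∑ i, y i ^ 2 = 1) {m : ℕ} {h : MvPolynomial (Fin (d + 1)) ℂ}
    (hh : h.IsHomogeneous m) (k : ℕ) :
    I (poleVar y ^ k * SphereKernel.dirDeriv y h) =
      (2 * k + m + d) * I (poleVar y ^ k * h) -
        2 * (k + m + d) * I (poleVar y ^ (k + 1) * h) := by
  have key := hI.dirDeriv y (poleVar y ^ k * h)
  rw [Derivation.leibniz, Derivation.leibniz, Derivation.leibniz_pow, Derivation.leibniz_pow,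
    dirDeriv_poleVar hy, eulerOp_poleVar, eulerOp_of_isHomogeneous hh] at key
  simp only [smul_eq_mul, nsmul_eq_mul] at key
  set s := poleVar y
  have e2 : (1 - C 2 * s) * (s ^ k * (C (m : ℂ) * h) +
      h * ((k : MvPolynomial (Fin (d + 1)) ℂ) * (s ^ (k - 1) * (s - C (1 / 2)))) +
        C (d : ℂ) * (s ^ k * h)) =
      C (2 * k + m + d : ℂ) * (s ^ k * h) - C (2 * (k + m + d) : ℂ) * (s ^ (k + 1) * h) +
        h * ((k : MvPolynomial (Fin (d + 1)) ℂ) * (s ^ (k - 1) * C (-(1 / 2)))) := by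
    have hC : (C (1 / 2 : ℂ) : MvPolynomial (Fin (d + 1)) ℂ) * 2 = 1 := by
      rw [← map_ofNat (C : ℂ →+* MvPolynomial (Fin (d + 1)) ℂ) 2, ← map_mul]; norm_num
    have h2 : (C (2 : ℂ) : MvPolynomial (Fin (d + 1)) ℂ) = 2 := map_ofNat _ 2
    rcases k with _ | k
    · simp only [map_add, map_mul, map_natCast, h2, map_neg]
      simp
      ring
    · simp only [map_add, map_mul, map_natCast, h2, map_neg, Nat.add_sub_cancel]
      push_cast
      linear_combination ((k + 1) * s ^ k * h * s) * hC
  rw [e2, map_add, map_add, map_sub, map_C_mul_apply, map_C_mul_apply] at key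
  linear_combination key

/-- Green's formula: summing the divergence theorem for `sᵏ ∂ᵢh` over `i`, with `h` harmonic. -/
theorem IsSpherical.green (hI : IsSpherical I) {m : ℕ}
    {h : MvPolynomial (Fin (d + 1)) ℂ} (hh : h.IsHomogeneous m) (hΔ : polyLaplacian d h = 0)
    (f : MvPolynomial (Fin (d + 1)) ℂ) :
    I (∑ i, MvPolynomial.pderiv i f * MvPolynomial.pderiv i h) =
      m * I (eulerOp d f * h) + m * (m + d - 1) * I (f * h) := by
  have h1 : I (∑ i, MvPolynomial.pderiv i (f * MvPolynomial.pderiv i h)) =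
      I (∑ i, X i * (eulerOp d (f * MvPolynomial.pderiv i h) +
        C (d : ℂ) * (f * MvPolynomial.pderiv i h))) := by
    simp only [map_sum]
    exact Finset.sum_congr rfl fun i _ => hI.pderiv i _
  have h2 : ∑ i, MvPolynomial.pderiv i (f * MvPolynomial.pderiv i h) =
      ∑ i, MvPolynomial.pderiv i f * MvPolynomial.pderiv i h := by
    simp only [pderiv_mul, Finset.sum_add_distrib, ← Finset.mul_sum, ← polyLaplacian_apply, hΔ]
    simp
  have h3 : ∑ i, X i * (eulerOp d (f * MvPolynomial.pderiv i h) +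
        C (d : ℂ) * (f * MvPolynomial.pderiv i h)) =
      C (m : ℂ) * (eulerOp d f * h) + C (m * (m + d - 1) : ℂ) * (f * h) := by
    have e : ∀ i, X i * (eulerOp d (f * MvPolynomial.pderiv i h) +
        C (d : ℂ) * (f * MvPolynomial.pderiv i h)) =
        (eulerOp d f + C (m + d - 1 : ℂ) * f) * (X i * MvPolynomial.pderiv i h) := fun i => by
      rw [Derivation.leibniz, eulerOp_pderiv, eulerOp_of_isHomogeneous hh, pderiv_C_mul]
      simp only [smul_eq_mul, map_sub, map_add, map_one]
      ring
    rw [Finset.sum_congr rfl fun i _ => e i, ← Finset.mul_sum, ← eulerOp_apply,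
      eulerOp_of_isHomogeneous hh]
    simp only [map_sub, map_add, map_one, map_mul]
    ring
  rw [← h2, h1, h3, map_add, map_C_mul_apply, map_C_mul_apply]

theorem IsSpherical.map_harmonic_eq_zero (hI : IsSpherical I) (hd : 2 ≤ d) {m : ℕ}
    {h : MvPolynomial (Fin (d + 1)) ℂ} (hh : h.IsHomogeneous m) (hΔ : polyLaplacian d h = 0)
    (hm : m ≠ 0) : I h = 0 := by
  have key := hI.green hh hΔ 1
  simp only [zero_mul, Finset.sum_const_zero, Derivation.map_one_eq_zero, map_zero,
    mul_zero, zero_add, one_mul] at key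
  have : (m * (m + d - 1) : ℂ) ≠ 0 := by
    have h1 : (m + d - 1 : ℂ) = ((m + (d - 1) : ℕ) : ℂ) := by
      push_cast [show 1 ≤ d by omega]; ring
    rw [h1]
    exact_mod_cast Nat.mul_ne_zero hm (by omega)
  exact (mul_eq_zero.mp key.symm).resolve_left this

/-- The two-term recursion for the moments `I(sᵏ h)`, expressing that `h` is an eigenfunction of the
spherical Laplacian. It eliminates `I(sᵏ ∂_y h)` between the two integrations by parts. -/
theorem IsSpherical.moment_succ (hI : IsSpherical I) {y : Fin (d + 1) → ℂ}
    (hy : ∑ i, y i ^ 2 = 1) {m : ℕ} {h : MvPolynomial (Fin (d + 1)) ℂ}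
    (hh : h.IsHomogeneous m) (hΔ : polyLaplacian d h = 0) (k : ℕ) :
    ((k + 1) * (k + d) - m * (m + d - 1)) * I (poleVar y ^ (k + 1) * h) =
      (k + 1) * (k + d / 2) * I (poleVar y ^ k * h) := by
  have h1 := hI.poleVar_pow_mul_dirDeriv hy hh k
  have h2 := hI.green hh hΔ (poleVar y ^ (k + 1))
  have e1 : ∑ i, MvPolynomial.pderiv i (poleVar y ^ (k + 1)) * MvPolynomial.pderiv i h =
      C (-((k + 1) / 2) : ℂ) * (poleVar y ^ k * SphereKernel.dirDeriv y h) := by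
    rw [dirDeriv_apply, Finset.mul_sum, Finset.mul_sum]
    refine Finset.sum_congr rfl fun i _ => ?_
    rw [pderiv_pow, pderiv_poleVar]
    simp only [div_eq_mul_inv, map_neg, map_mul, map_add, map_natCast, map_one, Nat.add_sub_cancel]
    push_cast
    ring
  have e2 : eulerOp d (poleVar y ^ (k + 1)) * h =
      C (k + 1 : ℂ) * (poleVar y ^ (k + 1) * h) - C ((k + 1) / 2 : ℂ) * (poleVar y ^ k * h) := by
    rw [Derivation.leibniz_pow, eulerOp_poleVar]
    simp only [div_eq_mul_inv, map_mul, map_add, map_natCast, map_one, Nat.add_sub_cancel,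
      smul_eq_mul, nsmul_eq_mul]
    push_cast
    ring
  rw [e1, e2, map_C_mul_apply, map_sub, map_C_mul_apply, map_C_mul_apply] at h2
  linear_combination (k + 1) / 2 * h1 + h2

/-- The factor `(k+1)(k+d) - m(m+d-1)` in the recursion vanishes only at `k + 1 = m`, so the moments
below `m` all vanish with the zeroth one. -/
theorem IsSpherical.moment_eq_zero (hI : IsSpherical I) (hd : 2 ≤ d) {y : Fin (d + 1) → ℂ}
    (hy : ∑ i, y i ^ 2 = 1) {m : ℕ} {h : MvPolynomial (Fin (d + 1)) ℂ}
    (hh : h.IsHomogeneous m) (hΔ : polyLaplacian d h = 0) {k : ℕ} (hk : k < m) :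
    I (poleVar y ^ k * h) = 0 := by
  induction k with
  | zero => simpa using hI.map_harmonic_eq_zero hd hh hΔ (by omega)
  | succ k ih =>
    have key := hI.moment_succ hy hh hΔ k
    rw [ih (by omega), mul_zero] at key
    refine (mul_eq_zero.mp key).resolve_left ?_
    obtain ⟨l, rfl⟩ := Nat.exists_eq_add_of_lt hk
    have : ((k + 1) * (k + d) - ((k + 1 + l + 1 : ℕ) : ℂ) * ((k + 1 + l + 1 : ℕ) + d - 1)) =
        -(((l + 1) * (k + (k + 1 + l + 1) + d) : ℕ) : ℂ) := by
      push_cast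
      ring
    rw [this, neg_eq_zero, Nat.cast_eq_zero]
    exact Nat.mul_ne_zero (by omega) (by omega)

/-- The first nonvanishing moment. Integration by parts in the direction of the pole trades a factor
`s` for the harmonic polynomial `∂_y h` of lower degree. -/
theorem IsSpherical.moment_self (hI : IsSpherical I) (hd : 2 ≤ d) {y : Fin (d + 1) → ℂ}
    (hy : ∑ i, y i ^ 2 = 1) {m : ℕ} {h : MvPolynomial (Fin (d + 1)) ℂ}
    (hh : h.IsHomogeneous m) (hΔ : polyLaplacian d h = 0) :
    I (poleVar y ^ m * h) * ∏ j ∈ Finset.range m, (-(2 * (2 * j + 1 + d)) : ℂ) =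
      m ! * I 1 * eval y h := by
  induction m generalizing h with
  | zero =>
    obtain ⟨c, rfl⟩ : ∃ c, h = C c :=
      ⟨_, totalDegree_eq_zero_iff_eq_C.mp (Nat.le_zero.mp hh.totalDegree_le)⟩
    have := map_C_mul_apply I c 1
    rw [mul_one] at this
    simp [this, mul_comm]
  | succ m ih =>
    have h1 := ih (isHomogeneous_dirDeriv hh y) (polyLaplacian_dirDeriv y hΔ)
    rw [hI.poleVar_pow_mul_dirDeriv hy hh, hI.moment_eq_zero hd hy hh hΔ (Nat.lt_succ_self m),
      eval_dirDeriv_self hh] at h1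
    rw [Finset.prod_range_succ, Nat.factorial_succ]
    push_cast at h1 ⊢
    linear_combination h1

/-! ### The kernel as a polynomial -/

/-- The coefficient of `sᵏ` in `Φ_n`, where `s = (1 - t) / 2`. -/
noncomputable def phiCoeff (d n k : ℕ) : ℝ :=
  ordinaryHypergeometricCoefficient ((n : ℝ) + (d : ℝ) - 1) (-(n : ℝ)) ((d : ℝ) / 2) k

theorem ascPochhammer_eval_half_ne_zero (hd : 2 ≤ d) (k : ℕ) :
    (ascPochhammer ℝ k).eval ((d : ℝ) / 2) ≠ 0 :=
  (ascPochhammer_pos k _ (by positivity)).ne'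

theorem phiCoeff_succ (hd : 2 ≤ d) (n k : ℕ) :
    phiCoeff d n (k + 1) * ((k + 1) * (k + d / 2)) =
      phiCoeff d n k * ((n + d - 1 + k) * (k - n)) := by
  have h1 := ascPochhammer_eval_half_ne_zero hd k
  have h2 : (d : ℝ) / 2 + k ≠ 0 := by positivity
  have h3 : ((k !: ℕ) : ℝ) ≠ 0 := by positivity
  simp only [phiCoeff, ordinaryHypergeometricCoefficient, ascPochhammer_succ_eval,
    Nat.factorial_succ]
  push_cast
  field_simp
  ring

theorem phiCoeff_eq_zero {n k : ℕ} (hk : n < k) : phiCoeff d n k = 0 := by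
  have : (ascPochhammer ℝ k).eval (-(n : ℝ)) = 0 :=
    (ascPochhammer_eval_eq_zero_iff k _).2 ⟨n, hk, by simp⟩
  simp [phiCoeff, ordinaryHypergeometricCoefficient, this]

theorem Phi_eq_sum (d n : ℕ) (t : ℝ) :
    Phi d n t = ∑ k ∈ Finset.range (n + 1), phiCoeff d n k * ((1 - t) / 2) ^ k := by
  rw [Phi, ordinaryHypergeometric_eq_tsum]
  refine tsum_eq_sum fun k hk => ?_
  rw [smul_eq_mul]
  exact mul_eq_zero_of_left (phiCoeff_eq_zero (by simpa using hk)) _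

theorem Phi_one (d n : ℕ) : Phi d n 1 = 1 := by
  simp [Phi]

theorem continuous_kernelProfile (d Ω : ℕ) : Continuous (kernelProfile d Ω) := by
  unfold kernelProfile
  simp only [Phi_eq_sum]
  fun_prop

/-- The duplication formula `(d/2)_m · ∏ 2(2j+1+d) = (2m+d-1)! / (d-1)!`, for `d = e + 2`. -/
theorem ascPochhammer_half_mul_prod (e m : ℕ) :
    (ascPochhammer ℝ m).eval (((e + 2 : ℕ) : ℝ) / 2) *
      ((∏ j ∈ Finset.range m, (2 * (2 * j + 1 + (e + 2 : ℕ)) : ℝ)) * (e + 1)!) =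
      (2 * m + e + 1)! := by
  induction m with
  | zero => simp
  | succ m ih =>
    have h : ((2 * (m + 1) + e + 1)! : ℝ) =
        (2 * m + e + 3) * ((2 * m + e + 2) * (2 * m + e + 1)!) := by
      rw [show 2 * (m + 1) + e + 1 = (2 * m + e + 1) + 1 + 1 by ring,
        Nat.factorial_succ (2 * m + e + 1 + 1), Nat.factorial_succ (2 * m + e + 1)]
      push_cast
      ring
    rw [ascPochhammer_succ_eval, Finset.prod_range_succ, h, ← ih]
    push_cast
    ring

/-- The top coefficient of `Φ_m` is matched to the first nonvanishing moment and to the dimension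
`d(m)`. -/
theorem phiCoeff_self_mul (hd : 2 ≤ d) (m : ℕ) :
    dimY d m * (phiCoeff d m m * m !) =
      ∏ j ∈ Finset.range m, (-(2 * (2 * j + 1 + d)) : ℝ) := by
  -- With `d = e + 2` the truncated subtractions in `dimY` disappear.
  obtain ⟨e, rfl⟩ := Nat.exists_eq_add_of_le' hd
  have h0 := ascPochhammer_eval_half_ne_zero hd m
  have h1 := ascPochhammer_half_mul_prod e m
  have h2 : (ascPochhammer ℝ m).eval (-(m : ℝ)) = (-1) ^ m * m ! := by
    rw [ascPochhammer_eval_neg_eq_descPochhammer, descPochhammer_eval_eq_descFactorial,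
      Nat.descFactorial_self]
  have h3 : ((m + e)! : ℝ) * (ascPochhammer ℝ m).eval ((m : ℝ) + ((e + 2 : ℕ) : ℝ) - 1) =
      (2 * m + e)! := by
    have : (m : ℝ) + ((e + 2 : ℕ) : ℝ) - 1 = ((m + e + 1 : ℕ) : ℝ) := by push_cast; ring
    rw [this, ← ascPochhammer_eval_cast, ascPochhammer_nat_eq_ascFactorial, ← Nat.cast_mul,
      Nat.factorial_mul_ascFactorial]
    congr 2
    ring
  have h4 : ∏ j ∈ Finset.range m, (-(2 * (2 * j + 1 + (e + 2 : ℕ))) : ℝ) =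
      (-1) ^ m * ∏ j ∈ Finset.range m, (2 * (2 * j + 1 + (e + 2 : ℕ)) : ℝ) := by
    rw [Finset.prod_neg]
    simp
  have h5 : ((2 * m + e + 1)! : ℝ) = (2 * m + e + 1) * (2 * m + e)! := by
    rw [Nat.factorial_succ]; push_cast; ring
  have h6 : (m ! : ℝ) ≠ 0 := by positivity
  have h7 : ((e + 1)! : ℝ) ≠ 0 := by positivity
  rw [h4, phiCoeff, ordinaryHypergeometricCoefficient, dimY, h2,
    show e + 2 + m - 2 = m + e by omega, show e + 2 - 1 = e + 1 by omega]
  rw [h5, ← h3] at h1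
  set A := (ascPochhammer ℝ m).eval (((e + 2 : ℕ) : ℝ) / 2)
  set B := (ascPochhammer ℝ m).eval ((m : ℝ) + ((e + 2 : ℕ) : ℝ) - 1)
  set Q := ∏ j ∈ Finset.range m, (2 * (2 * j + 1 + (e + 2 : ℕ)) : ℝ)
  field_simp
  push_cast
  linear_combination -h1

/-- `x ↦ Φ_n((x, y))` as a polynomial in `x`. -/
noncomputable def phiPoly {d : ℕ} (n : ℕ) (y : Fin (d + 1) → ℂ) : MvPolynomial (Fin (d + 1)) ℂ :=
  ∑ k ∈ Finset.range (n + 1), C (phiCoeff d n k : ℂ) * poleVar y ^ k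

/-- `x ↦ F_{φ_Ω}((x, y))` as a polynomial in `x`. -/
noncomputable def kernelPoly {d : ℕ} (Ω : ℕ) (y : Fin (d + 1) → ℂ) :
    MvPolynomial (Fin (d + 1)) ℂ :=
  ∑ n ∈ Finset.range (Ω + 1), C (dimY d n : ℂ) * phiPoly n y

theorem totalDegree_kernelPoly_le (Ω : ℕ) (y : Fin (d + 1) → ℂ) :
    (kernelPoly Ω y).totalDegree ≤ Ω := by
  have hs : (poleVar y).totalDegree ≤ 1 := by
    refine (totalDegree_mul _ _).trans ?_
    rw [totalDegree_C, zero_add]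
    refine (totalDegree_sub _ _).trans (max_le (by simp) ?_)
    refine totalDegree_finsetSum_le fun i _ => ?_
    refine (totalDegree_mul _ _).trans ?_
    rw [totalDegree_C, zero_add, totalDegree_X]
  refine totalDegree_finsetSum_le fun n hn => (totalDegree_mul _ _).trans ?_
  rw [totalDegree_C, zero_add]
  refine totalDegree_finsetSum_le fun k hk => (totalDegree_mul _ _).trans ?_
  rw [totalDegree_C, zero_add]
  refine (totalDegree_pow _ _).trans ((Nat.mul_le_mul_left k hs).trans ?_)
  simp only [Finset.mem_range] at hn hk
  omega

theorem map_phiPoly_mul (n : ℕ) (y : Fin (d + 1) → ℂ) (h : MvPolynomial (Fin (d + 1)) ℂ) :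
    I (phiPoly n y * h) =
      ∑ k ∈ Finset.range (n + 1), (phiCoeff d n k : ℂ) * I (poleVar y ^ k * h) := by
  simp only [phiPoly, Finset.sum_mul, map_sum, mul_assoc, map_C_mul_apply]

/-- `Φ_n((·, y))` is orthogonal to the harmonic polynomials of every other degree `m`: the
hypergeometric recursion of the coefficients and the recursion of the moments show that the
integral is multiplied by the same amount by two different eigenvalues of the spherical
Laplacian. -/
theorem IsSpherical.map_phiPoly_mul_of_ne (hI : IsSpherical I) (hd : 2 ≤ d)
    {y : Fin (d + 1) → ℂ} (hy : ∑ i, y i ^ 2 = 1) {m n : ℕ} {h : MvPolynomial (Fin (d + 1)) ℂ}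
    (hh : h.IsHomogeneous m) (hΔ : polyLaplacian d h = 0) (hmn : m ≠ n) :
    I (phiPoly n y * h) = 0 := by
  rw [map_phiPoly_mul]
  set a : ℕ → ℂ := fun k => I (poleVar y ^ k * h) with ha
  set c : ℕ → ℂ := fun k => (phiCoeff d n k : ℂ) with hc
  change ∑ k ∈ Finset.range (n + 1), c k * a k = 0
  have hcs : ∀ k : ℕ, c (k + 1) * ((k + 1) * (k + d / 2)) = c k * ((n + d - 1 + k) * (k - n)) :=
    fun k => by
      have := congrArg (fun x : ℝ => (x : ℂ)) (phiCoeff_succ hd n k)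
      push_cast at this
      exact this
  have has : ∀ k : ℕ, ((k + 1) * (k + d) - m * (m + d - 1)) * a (k + 1) =
      (k + 1) * (k + d / 2) * a k := hI.moment_succ hy hh hΔ
  have ha0 : (m * (m + d - 1) : ℂ) * a 0 = 0 := by
    rcases eq_or_ne m 0 with rfl | hm
    · simp
    · simp [ha, hI.map_harmonic_eq_zero hd hh hΔ hm]
  have hcn : c (n + 1) = 0 := by simp [hc, phiCoeff_eq_zero (Nat.lt_succ_self n)]
  -- Both recursions shift the index by one, so the coefficient recursion is moved to the moments;
  -- the boundary terms vanish because `c (n + 1) = 0` and by `ha0`.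
  have h1 : ∑ k ∈ Finset.range (n + 1), (k * (k + d - 1) - m * (m + d - 1)) * (c k * a k) =
      ∑ k ∈ Finset.range (n + 1), (n + d - 1 + k) * (k - n) * (c k * a k) := by
    rw [Finset.sum_range_succ']
    have e : ∀ k : ℕ, (n + d - 1 + k) * (k - n) * (c k * a k) =
        (((k + 1 : ℕ) : ℂ) * ((k + 1 : ℕ) + d - 1) - m * (m + d - 1)) *
          (c (k + 1) * a (k + 1)) := fun k => by
      push_cast
      linear_combination (-a k) * hcs k - c (k + 1) * has k
    rw [Finset.sum_congr rfl fun k _ => e k, Finset.sum_range_succ _ n, hcn]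
    push_cast
    linear_combination (-c 0) * ha0
  have h2 : ((n * (n + d - 1) - m * (m + d - 1)) : ℂ) *
      ∑ k ∈ Finset.range (n + 1), c k * a k = 0 := by
    rw [Finset.mul_sum, ← sub_eq_zero.mpr h1, ← Finset.sum_sub_distrib]
    exact Finset.sum_congr rfl fun k _ => by ring
  refine (mul_eq_zero.mp h2).resolve_left ?_
  have e : ((n * (n + d - 1) - m * (m + d - 1)) : ℂ) = (n - m) * ((n + m + (d - 1) : ℕ) : ℂ) := by
    push_cast [show 1 ≤ d by omega]
    ring
  rw [e]
  exact mul_ne_zero (sub_ne_zero.mpr (by exact_mod_cast hmn.symm))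
    (by exact_mod_cast (by omega : n + m + (d - 1) ≠ 0))

theorem IsSpherical.map_phiPoly_mul_self (hI : IsSpherical I) (hd : 2 ≤ d)
    {y : Fin (d + 1) → ℂ} (hy : ∑ i, y i ^ 2 = 1) {m : ℕ} {h : MvPolynomial (Fin (d + 1)) ℂ}
    (hh : h.IsHomogeneous m) (hΔ : polyLaplacian d h = 0) :
    dimY d m * I (phiPoly m y * h) = I 1 * eval y h := by
  rw [map_phiPoly_mul, Finset.sum_range_succ, Finset.sum_eq_zero fun k hk => by
    rw [hI.moment_eq_zero hd hy hh hΔ (Finset.mem_range.mp hk), mul_zero], zero_add]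
  have h1 := hI.moment_self hd hy hh hΔ
  have h2 := congrArg (fun x : ℝ => (x : ℂ)) (phiCoeff_self_mul hd m)
  push_cast at h2
  rw [← h2] at h1
  have h3 : (m ! : ℂ) ≠ 0 := by exact_mod_cast m.factorial_ne_zero
  apply mul_left_cancel₀ h3
  linear_combination h1

theorem IsSpherical.map_kernelPoly_mul_harmonic (hI : IsSpherical I) (hd : 2 ≤ d)
    {y : Fin (d + 1) → ℂ} (hy : ∑ i, y i ^ 2 = 1) {m Ω : ℕ} (hm : m ≤ Ω)
    {h : MvPolynomial (Fin (d + 1)) ℂ} (hh : h.IsHomogeneous m) (hΔ : polyLaplacian d h = 0) :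
    I (kernelPoly Ω y * h) = I 1 * eval y h := by
  simp only [kernelPoly, Finset.sum_mul, map_sum, mul_assoc, map_C_mul_apply]
  rw [Finset.sum_eq_single m]
  · exact hI.map_phiPoly_mul_self hd hy hh hΔ
  · intro n _ hn
    rw [hI.map_phiPoly_mul_of_ne hd hy hh hΔ hn.symm, mul_zero]
  · intro hm'
    exact absurd (Finset.mem_range.mpr (by omega)) hm'

/-! ### Decomposition of polynomials into harmonic ones -/

theorem sqNorm_isHomogeneous (d : ℕ) : (sqNorm d).IsHomogeneous 2 :=
  MvPolynomial.IsHomogeneous.sum _ _ _ fun i _ => isHomogeneous_X_pow i 2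

theorem polyLaplacian_sqNorm_mul {k : ℕ} {f : MvPolynomial (Fin (d + 1)) ℂ}
    (hf : f.IsHomogeneous k) :
    polyLaplacian d (sqNorm d * f) =
      C ((2 * (d + 1) + 4 * k : ℕ) : ℂ) * f + sqNorm d * polyLaplacian d f := by
  have h1 : ∀ i, pderiv i (sqNorm d) = C 2 * X i := fun i => by
    simp [sqNorm, pderiv_X, Pi.single_apply, map_ofNat C 2]
  have h2 : ∀ i, pderiv i (pderiv i (sqNorm d * f)) =
      C 2 * f + C 4 * (X i * pderiv i f) + sqNorm d * pderiv i (pderiv i f) := fun i => by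
    rw [pderiv_mul, h1, map_add, pderiv_mul, pderiv_C_mul, pderiv_mul, h1, pderiv_X_self,
      show (4 : ℂ) = 2 + 2 by norm_num, map_add]
    ring
  rw [polyLaplacian_apply, Finset.sum_congr rfl fun i _ => h2 i, Finset.sum_add_distrib,
    Finset.sum_add_distrib, ← Finset.mul_sum, ← Finset.mul_sum, ← Finset.mul_sum,
    ← polyLaplacian_apply, ← eulerOp_apply, eulerOp_of_isHomogeneous hf]
  simp
  ring

theorem exists_polyLaplacian_sqNorm_pow_succ_mul {m : ℕ} {h : MvPolynomial (Fin (d + 1)) ℂ}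
    (hh : h.IsHomogeneous m) (hΔ : polyLaplacian d h = 0) (j : ℕ) :
    ∃ c : ℕ, c ≠ 0 ∧
      polyLaplacian d (sqNorm d ^ (j + 1) * h) = C (c : ℂ) * (sqNorm d ^ j * h) := by
  induction j with
  | zero =>
    refine ⟨2 * (d + 1) + 4 * m, by omega, ?_⟩
    rw [zero_add, pow_one, polyLaplacian_sqNorm_mul hh, hΔ]
    simp
  | succ j ih =>
    obtain ⟨c, -, ih⟩ := ih
    refine ⟨2 * (d + 1) + 4 * (2 * (j + 1) + m) + c, by omega, ?_⟩
    rw [pow_succ' _ (j + 1), mul_assoc,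
      polyLaplacian_sqNorm_mul (((sqNorm_isHomogeneous d).pow (j + 1)).mul hh), ih]
    push_cast
    simp only [map_add, map_mul, map_natCast]
    ring

/-- The span of the products `(∑ xᵢ²)ʲ h` of degree `k`, with `h` homogeneous and harmonic. -/
noncomputable def harmonicSpan (d k : ℕ) : Submodule ℂ (MvPolynomial (Fin (d + 1)) ℂ) :=
  Submodule.span ℂ {p | ∃ j m h, 2 * j + m = k ∧ MvPolynomial.IsHomogeneous h m ∧
    polyLaplacian d h = 0 ∧ p = sqNorm d ^ j * h}

theorem harmonicSpan_le_homogeneousSubmodule (d k : ℕ) :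
    harmonicSpan d k ≤ homogeneousSubmodule (Fin (d + 1)) ℂ k := by
  refine Submodule.span_le.mpr ?_
  rintro _ ⟨j, m, h, rfl, hh, -, rfl⟩
  exact ((sqNorm_isHomogeneous d).pow j).mul hh

/-- The Laplacian maps the span in degree `k + 2` onto the span in degree `k`. -/
theorem exists_polyLaplacian_eq {k : ℕ} {w : MvPolynomial (Fin (d + 1)) ℂ}
    (hw : w ∈ harmonicSpan d k) : ∃ q ∈ harmonicSpan d (k + 2), polyLaplacian d q = w := by
  suffices harmonicSpan d k ≤ (harmonicSpan d (k + 2)).map (polyLaplacian d) from this hw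
  refine Submodule.span_le.mpr ?_
  rintro _ ⟨j, m, h, rfl, hh, hΔ, rfl⟩
  obtain ⟨c, hc, e⟩ := exists_polyLaplacian_sqNorm_pow_succ_mul hh hΔ j
  have hc' : (c : ℂ) ≠ 0 := by exact_mod_cast hc
  refine ⟨(c : ℂ)⁻¹ • (sqNorm d ^ (j + 1) * h), Submodule.smul_mem _ _
    (Submodule.subset_span ⟨j + 1, m, h, by ring, hh, hΔ, rfl⟩), ?_⟩
  rw [map_smul, e, ← smul_eq_C_mul, smul_smul, inv_mul_cancel₀ hc', one_smul]

theorem polyLaplacian_eq_zero_of_lt_two {k : ℕ} (hk : k < 2) {p : MvPolynomial (Fin (d + 1)) ℂ}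
    (hp : p.IsHomogeneous k) : polyLaplacian d p = 0 := by
  rw [polyLaplacian_apply]
  refine Finset.sum_eq_zero fun i _ => ?_
  have h : (pderiv i p).totalDegree = 0 := by
    have := (hp.pderiv (i := i)).totalDegree_le
    omega
  rw [totalDegree_eq_zero_iff_eq_C.mp h, pderiv_C]

/-- Every homogeneous polynomial is a combination of products of powers of `∑ xᵢ²` with harmonic
polynomials: the Laplacian of `p` is also that of a combination `q` of the required form, and
`p - q` is harmonic. -/
theorem homogeneousSubmodule_le_harmonicSpan (d k : ℕ) :
    homogeneousSubmodule (Fin (d + 1)) ℂ k ≤ harmonicSpan d k := by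
  induction k using Nat.strong_induction_on with
  | _ k ih =>
    intro p hp
    rw [mem_homogeneousSubmodule] at hp
    have hmem : ∀ h : MvPolynomial (Fin (d + 1)) ℂ, h.IsHomogeneous k → polyLaplacian d h = 0 →
        h ∈ harmonicSpan d k := fun h hh hΔ =>
      Submodule.subset_span ⟨0, k, h, by simp, hh, hΔ, by simp⟩
    rcases lt_or_ge k 2 with hk | hk
    · exact hmem p hp (polyLaplacian_eq_zero_of_lt_two hk hp)
    · obtain ⟨l, rfl⟩ := Nat.exists_eq_add_of_le' hk
      have hl : (polyLaplacian d p).IsHomogeneous l := by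
        rw [polyLaplacian_apply]
        exact MvPolynomial.IsHomogeneous.sum _ _ _ fun i _ => hp.pderiv.pderiv
      obtain ⟨q, hq, e⟩ := exists_polyLaplacian_eq (ih l (by omega) hl)
      have hq' : q.IsHomogeneous (l + 2) := harmonicSpan_le_homogeneousSubmodule d _ hq
      rw [← sub_add_cancel p q]
      exact Submodule.add_mem _ (hmem _ (hp.sub hq') (by rw [map_sub, e, sub_self])) hq

/-- The harmonic decomposition as an induction principle for polynomials of degree at most `Ω`. -/
theorem restrictTotalDegree_le_of_harmonic {Ω : ℕ}
    {S : Submodule ℂ (MvPolynomial (Fin (d + 1)) ℂ)}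
    (hS : ∀ j m h, m ≤ Ω → MvPolynomial.IsHomogeneous h m → polyLaplacian d h = 0 →
      sqNorm d ^ j * h ∈ S) :
    restrictTotalDegree (Fin (d + 1)) ℂ Ω ≤ S := by
  intro p hp
  rw [mem_restrictTotalDegree] at hp
  rw [← sum_homogeneousComponent p]
  refine Submodule.sum_mem _ fun k hk => ?_
  refine (homogeneousSubmodule_le_harmonicSpan d k).trans ?_ (homogeneousComponent_mem k p)
  refine Submodule.span_le.mpr ?_
  rintro _ ⟨j, m, h, rfl, hh, hΔ, rfl⟩
  rw [Finset.mem_range] at hk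
  exact hS j m h (by omega) hh hΔ

/-- The reproducing property of the kernel on all polynomials of degree at most `Ω`. -/
theorem IsSpherical.map_kernelPoly_mul (hI : IsSpherical I) (hd : 2 ≤ d)
    {y : Fin (d + 1) → ℂ} (hy : ∑ i, y i ^ 2 = 1) {Ω : ℕ} {p : MvPolynomial (Fin (d + 1)) ℂ}
    (hp : p ∈ restrictTotalDegree (Fin (d + 1)) ℂ Ω) :
    I (kernelPoly Ω y * p) = I 1 * eval y p := by
  have hsq : eval y (sqNorm d) = 1 := by simpa [sqNorm] using hy
  have hsub : restrictTotalDegree (Fin (d + 1)) ℂ Ω ≤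
      LinearMap.eqLocus (I ∘ₗ LinearMap.mulLeft ℂ (kernelPoly Ω y))
        (I 1 • (aeval y : MvPolynomial (Fin (d + 1)) ℂ →ₐ[ℂ] ℂ).toLinearMap) := by
    refine restrictTotalDegree_le_of_harmonic fun j m h hm hh hΔ => ?_
    have e : ∀ q, I (sqNorm d ^ j * q) = I q := by
      induction j with
      | zero => simp
      | succ j ih => intro q; rw [pow_succ', mul_assoc, hI.sqNorm_mul, ih]
    simp only [LinearMap.mem_eqLocus, LinearMap.comp_apply, LinearMap.mulLeft_apply,
      LinearMap.smul_apply, AlgHom.toLinearMap_apply, aeval_eq_eval, smul_eq_mul, map_mul, map_pow]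
    rw [mul_left_comm, e, hI.map_kernelPoly_mul_harmonic hd hy hm hh hΔ]
    simp [hsq]
  simpa [LinearMap.mem_eqLocus, aeval_eq_eval] using hsub hp

/-! ### Invariance of the measure on the sphere -/

instance (d : ℕ) : IsProbabilityMeasure (sigma d) := by
  have h : (volume : Measure (EuclideanSpace ℝ (Fin (d + 1)))).toSphere ≠ 0 :=
    Measure.toSphere_ne_zero _
  constructor
  rw [sigma, Measure.smul_apply, smul_eq_mul]
  exact ENNReal.inv_mul_cancel (Measure.measure_univ_ne_zero.mpr h) (measure_ne_top _ _)

/-- The map of the sphere induced by a linear isometry. -/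
noncomputable def sphereMap
    (T : EuclideanSpace ℝ (Fin (d + 1)) →ₗᵢ[ℝ] EuclideanSpace ℝ (Fin (d + 1)))
    (x : Sph d) : Sph d :=
  ⟨T x.1, by simp⟩

open scoped Pointwise in
/-- The surface measure of `s` is a multiple of the volume of the cone over `s`, and linear
isometries preserve volume. -/
theorem measurePreserving_sphereMap
    (T : EuclideanSpace ℝ (Fin (d + 1)) →ₗᵢ[ℝ] EuclideanSpace ℝ (Fin (d + 1))) :
    MeasurePreserving (sphereMap T) (sigma d) (sigma d) := by
  have hc : Continuous (sphereMap T) :=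
    Continuous.subtype_mk (T.continuous.comp continuous_subtype_val) _
  refine MeasurePreserving.smul_measure ⟨hc.measurable, ?_⟩ _
  ext s hs
  rw [Measure.map_apply hc.measurable hs, Measure.toSphere_apply' _ hs,
    Measure.toSphere_apply' _ (hc.measurable hs)]
  congr 1
  set U := T.toLinearIsometryEquiv rfl with hU
  have hUT : ∀ v, U v = T v := fun v => rfl
  have hset : Set.Ioo (0 : ℝ) 1 • (Subtype.val '' (sphereMap T ⁻¹' s)) =
      U ⁻¹' (Set.Ioo (0 : ℝ) 1 • (Subtype.val '' s)) := by
    ext v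
    simp only [Set.mem_smul, Set.mem_image, Set.mem_preimage]
    constructor
    · rintro ⟨r, hr, _, ⟨x, hx, rfl⟩, rfl⟩
      exact ⟨r, hr, _, ⟨_, hx, rfl⟩, by rw [map_smul]; rfl⟩
    · rintro ⟨r, hr, _, ⟨x, hx, rfl⟩, hv⟩
      have hx' : ‖U.symm x.1‖ = 1 := by simp
      refine ⟨r, hr, _, ⟨⟨U.symm x.1, by simp⟩, ?_, rfl⟩, ?_⟩
      · have : sphereMap T ⟨U.symm x.1, by simp⟩ = x := Subtype.ext (by
          simp [sphereMap, ← hUT])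
        rwa [this]
      · rw [← map_smul, hv, U.symm_apply_apply]
  rw [hset]
  exact U.measurePreserving.measure_preimage_equiv (f := U.toMeasurableEquiv) _

/-- The coordinates of a point of the sphere, as complex numbers. -/
def coords (x : Sph d) : Fin (d + 1) → ℂ := fun i => ((x.1 i : ℝ) : ℂ)

theorem restrictSphere_apply (p : MvPolynomial (Fin (d + 1)) ℂ) (x : Sph d) :
    restrictSphere d p x = eval (coords x) p := rfl

theorem continuous_coords : Continuous (coords : Sph d → _) := by
  unfold coords
  fun_prop

theorem continuous_restrictSphere (p : MvPolynomial (Fin (d + 1)) ℂ) :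
    Continuous (restrictSphere d p) :=
  (MvPolynomial.continuous_eval p).comp continuous_coords

theorem sum_coords_sq (x : Sph d) : ∑ i, coords x i ^ 2 = 1 := by
  have h1 : ‖x.1‖ ^ 2 = 1 := by simp
  rw [EuclideanSpace.real_norm_sq_eq] at h1
  simpa [coords] using congrArg (fun t : ℝ => (t : ℂ)) h1

theorem integrable_of_continuous {E : Type*} [NormedAddCommGroup E] {f : Sph d → E}
    (hf : Continuous f) : Integrable f (sigma d) :=
  hf.integrable_of_hasCompactSupport (HasCompactSupport.of_compactSpace f)

/-- Integration over the sphere, as a linear functional on polynomials. -/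
noncomputable def sphereIntegral (d : ℕ) : MvPolynomial (Fin (d + 1)) ℂ →ₗ[ℂ] ℂ where
  toFun p := ∫ x, restrictSphere d p x ∂(sigma d)
  map_add' p q := by
    simp only [map_add, Pi.add_apply]
    exact integral_add (integrable_of_continuous (continuous_restrictSphere p))
      (integrable_of_continuous (continuous_restrictSphere q))
  map_smul' c p := by
    simp only [map_smul, Pi.smul_apply, RingHom.id_apply]
    exact integral_smul c _

theorem sphereIntegral_apply (p : MvPolynomial (Fin (d + 1)) ℂ) :
    sphereIntegral d p = ∫ x, restrictSphere d p x ∂(sigma d) := rfl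

/-- The rotation by the angle `θ` in the coordinate plane of `i` and `j`. -/
noncomputable def planeRot (i j : Fin (d + 1)) (hij : i ≠ j) (θ : ℝ) :
    EuclideanSpace ℝ (Fin (d + 1)) →ₗᵢ[ℝ] EuclideanSpace ℝ (Fin (d + 1)) where
  toFun x := x + ((Real.cos θ - 1) * x i - Real.sin θ * x j) • EuclideanSpace.single i 1 +
    (Real.sin θ * x i + (Real.cos θ - 1) * x j) • EuclideanSpace.single j 1
  map_add' x y := by
    simp only [PiLp.add_apply]
    module
  map_smul' c x := by
    simp only [PiLp.smul_apply, smul_eq_mul, RingHom.id_apply]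
    module
  norm_map' x := by
    change ‖x + ((Real.cos θ - 1) * x i - Real.sin θ * x j) • EuclideanSpace.single i 1 +
      (Real.sin θ * x i + (Real.cos θ - 1) * x j) • EuclideanSpace.single j 1‖ = ‖x‖
    set a := (Real.cos θ - 1) * x i - Real.sin θ * x j with ha
    set b := Real.sin θ * x i + (Real.cos θ - 1) * x j with hb
    refine (sq_eq_sq₀ (norm_nonneg _) (norm_nonneg _)).mp ?_
    rw [EuclideanSpace.real_norm_sq_eq, EuclideanSpace.real_norm_sq_eq]
    have e : ∀ k, (x + a • EuclideanSpace.single i (1 : ℝ) + b • EuclideanSpace.single j (1 : ℝ) :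
        EuclideanSpace ℝ (Fin (d + 1))) k ^ 2 =
        x k ^ 2 + (if k = i then 2 * a * x i + a ^ 2 else 0) +
          (if k = j then 2 * b * x j + b ^ 2 else 0) := fun k => by
      simp only [PiLp.add_apply, PiLp.smul_apply, PiLp.single_apply, smul_eq_mul]
      rcases eq_or_ne k i with rfl | hki
      · simp [hij]
        ring
      · rcases eq_or_ne k j with rfl | hkj
        · simp [hki]
          ring
        · simp [hki, hkj]
    rw [Finset.sum_congr rfl fun k _ => e k]
    simp only [Finset.sum_add_distrib, Finset.sum_ite_eq', Finset.mem_univ, if_true]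
    rw [ha, hb]
    linear_combination (x i ^ 2 + x j ^ 2) * Real.sin_sq_add_cos_sq θ

theorem planeRot_apply (i j : Fin (d + 1)) (hij : i ≠ j) (θ : ℝ)
    (x : EuclideanSpace ℝ (Fin (d + 1))) (k : Fin (d + 1)) :
    planeRot i j hij θ x k = x k +
      (if k = i then (Real.cos θ - 1) * x i - Real.sin θ * x j else 0) +
      (if k = j then Real.sin θ * x i + (Real.cos θ - 1) * x j else 0) := by
  simp [planeRot]

/-- The chain rule for a polynomial along a differentiable curve. -/
theorem hasDerivAt_eval {c c' : ℝ → Fin (d + 1) → ℂ} {θ : ℝ}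
    (hc : ∀ k, HasDerivAt (fun t => c t k) (c' θ k) θ) (p : MvPolynomial (Fin (d + 1)) ℂ) :
    HasDerivAt (fun t => eval (c t) p) (∑ k, c' θ k * eval (c θ) (pderiv k p)) θ := by
  induction p using MvPolynomial.induction_on with
  | C a => simpa using hasDerivAt_const θ a
  | add p q hp hq =>
    simp only [map_add, mul_add, Finset.sum_add_distrib]
    exact hp.add hq
  | mul_X p i hp =>
    simp only [map_mul, eval_X]
    refine (hp.fun_mul (hc i)).congr_deriv ?_
    simp only [pderiv_mul, map_add, map_mul, eval_X, pderiv_X, Pi.single_apply, mul_add,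
      Finset.sum_add_distrib, Finset.sum_mul]
    congr 1
    · exact Finset.sum_congr rfl fun k _ => by ring
    · rw [Finset.sum_eq_single i]
      · simp [mul_comm]
      · intro k _ hk
        simp [hk.symm]
      · simp

/-- The infinitesimal generator of the rotations in the plane of `i` and `j` is `xᵢ ∂ⱼ - xⱼ ∂ᵢ`. -/
theorem hasDerivAt_planeRot (i j : Fin (d + 1)) (hij : i ≠ j) (x : Sph d) (θ : ℝ)
    (p : MvPolynomial (Fin (d + 1)) ℂ) :
    HasDerivAt (fun t => restrictSphere d p (sphereMap (planeRot i j hij t) x))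
      (restrictSphere d (X i * pderiv j p - X j * pderiv i p)
        (sphereMap (planeRot i j hij θ) x)) θ := by
  set c : ℝ → Fin (d + 1) → ℂ := fun t => coords (sphereMap (planeRot i j hij t) x) with hc
  have hck : ∀ t k, c t k = ((planeRot i j hij t x.1 k : ℝ) : ℂ) := fun t k => rfl
  have hi : ∀ t, c t i = ((Real.cos t * x.1 i - Real.sin t * x.1 j : ℝ) : ℂ) := fun t => by
    rw [hck, planeRot_apply, if_pos rfl, if_neg hij]
    congr 1
    ring
  have hj : ∀ t, c t j = ((Real.sin t * x.1 i + Real.cos t * x.1 j : ℝ) : ℂ) := fun t => by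
    rw [hck, planeRot_apply, if_pos rfl, if_neg hij.symm]
    congr 1
    ring
  have key := hasDerivAt_eval (c := c) (θ := θ)
    (c' := fun t k => if k = j then c t i else if k = i then -c t j else 0) (fun k => by
      rcases eq_or_ne k j with rfl | hkj
      · simp only [if_true, hi, hj]
        refine HasDerivAt.ofReal_comp ?_
        exact (((Real.hasDerivAt_sin θ).mul_const (x.1 i)).fun_add
          ((Real.hasDerivAt_cos θ).mul_const (x.1 k))).congr_deriv (by ring)
      · rcases eq_or_ne k i with rfl | hki
        · simp only [if_neg hkj, if_true, hi, hj]
          rw [← Complex.ofReal_neg]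
          refine HasDerivAt.ofReal_comp ?_
          exact (((Real.hasDerivAt_cos θ).mul_const (x.1 k)).fun_sub
            ((Real.hasDerivAt_sin θ).mul_const (x.1 j))).congr_deriv (by ring)
        · simp only [if_neg hkj, if_neg hki]
          have : (fun t => c t k) = fun _ => ((x.1 k : ℝ) : ℂ) := by
            funext t
            rw [hck, planeRot_apply, if_neg hki, if_neg hkj]
            simp
          rw [this]
          exact hasDerivAt_const _ _) p
  refine HasDerivAt.congr_deriv (f := fun t => eval (c t) p) key ?_
  change _ = eval (c θ) _
  rw [← Finset.sum_subset (Finset.subset_univ {j, i}) (by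
    intro k _ hk
    simp only [Finset.mem_insert, Finset.mem_singleton, not_or] at hk
    simp [hk.1, hk.2]), Finset.sum_pair hij.symm]
  simp [hij, sub_eq_add_neg]

/-- Differentiating the invariance of the integral under rotations in a coordinate plane. -/
theorem sphereIntegral_rot (i j : Fin (d + 1)) (p : MvPolynomial (Fin (d + 1)) ℂ) :
    sphereIntegral d (X i * pderiv j p) = sphereIntegral d (X j * pderiv i p) := by
  rcases eq_or_ne i j with rfl | hij
  · rfl
  set q := X i * pderiv j p - X j * pderiv i p with hq
  have hcont : ∀ (f : MvPolynomial (Fin (d + 1)) ℂ) (θ : ℝ),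
      Continuous fun x => restrictSphere d f (sphereMap (planeRot i j hij θ) x) := fun f θ =>
    (continuous_restrictSphere f).comp
      (Continuous.subtype_mk ((planeRot i j hij θ).continuous.comp continuous_subtype_val) _)
  obtain ⟨B, hB⟩ := (isCompact_range (continuous_restrictSphere q)).isBounded.exists_norm_le
  have key := (hasDerivAt_integral_of_dominated_loc_of_deriv_le (μ := sigma d) (𝕜 := ℝ)
    (F := fun θ x => restrictSphere d p (sphereMap (planeRot i j hij θ) x))
    (F' := fun θ x => restrictSphere d q (sphereMap (planeRot i j hij θ) x))
    (x₀ := 0) (s := Set.univ) (bound := fun _ => B) univ_mem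
    (Eventually.of_forall fun θ => (hcont p θ).aestronglyMeasurable)
    (integrable_of_continuous (hcont p 0)) (hcont q 0).aestronglyMeasurable
    (ae_of_all _ fun x θ _ => hB _ ⟨_, rfl⟩) (integrable_const B)
    (ae_of_all _ fun x θ _ => hasDerivAt_planeRot i j hij x θ p)).2
  have hinv : ∀ (f : MvPolynomial (Fin (d + 1)) ℂ) (θ : ℝ),
      ∫ x, restrictSphere d f (sphereMap (planeRot i j hij θ) x) ∂(sigma d) =
        sphereIntegral d f := fun f θ => by
    have hmp := measurePreserving_sphereMap (planeRot i j hij θ)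
    rw [sphereIntegral_apply]
    conv_rhs => rw [← hmp.map_eq]
    exact (integral_map hmp.measurable.aemeasurable
      (continuous_restrictSphere f).aestronglyMeasurable).symm
  simp only [hinv] at key
  have h0 := key.unique (hasDerivAt_const (0 : ℝ) (sphereIntegral d p))
  rw [hq, map_sub] at h0
  exact sub_eq_zero.mp h0

theorem restrictSphere_sqNorm_mul (p : MvPolynomial (Fin (d + 1)) ℂ) :
    restrictSphere d (sqNorm d * p) = restrictSphere d p := by
  ext x
  have : eval (coords x) (sqNorm d) = 1 := by simpa [sqNorm] using sum_coords_sq x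
  simp [restrictSphere_apply, this]

theorem isSpherical_sphereIntegral (d : ℕ) : IsSpherical (sphereIntegral d) where
  rot := sphereIntegral_rot
  sqNorm_mul p := by simp only [sphereIntegral_apply, restrictSphere_sqNorm_mul]

theorem sphereIntegral_one (d : ℕ) : sphereIntegral d 1 = 1 := by
  simp [sphereIntegral_apply, restrictSphere_apply]

/-! ### The orbit map of the rotation group -/

instance (d : ℕ) : (haarRot d).IsHaarMeasure := by
  unfold haarRot; infer_instance

instance (d : ℕ) : IsProbabilityMeasure (haarRot d) :=
  ⟨by simpa [haarRot] using
    Measure.haarMeasure_self (K₀ := (⊤ : TopologicalSpace.PositiveCompacts (Rot d)))⟩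

theorem continuous_rotate : Continuous fun q : Rot d × Sph d => rotate q.1 q.2 := by
  refine Continuous.subtype_mk ?_ _
  refine (PiLp.continuous_toLp 2 _).comp ?_
  refine Continuous.matrix_mulVec (by fun_prop) ?_
  exact (PiLp.continuous_ofLp 2 _).comp (continuous_subtype_val.comp continuous_snd)

theorem rotate_mul (a b : Rot d) (x : Sph d) : rotate (a * b) x = rotate a (rotate b x) := by
  refine Subtype.ext ?_
  simp [rotate, Matrix.mulVec_mulVec]

theorem rotate_one (x : Sph d) : rotate 1 x = x := by
  refine Subtype.ext ?_
  simp [rotate]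

/-- A rotation as a linear isometry of the ambient space. -/
noncomputable def rotIsometry (a : Rot d) :
    EuclideanSpace ℝ (Fin (d + 1)) →ₗᵢ[ℝ] EuclideanSpace ℝ (Fin (d + 1)) :=
  LinearMap.isometryOfInner (Matrix.toEuclideanLin a.1) fun x y => by
    have ha : a.1.transpose * a.1 = 1 :=
      (Matrix.mem_orthogonalGroup_iff' _ _).mp (Matrix.mem_specialOrthogonalGroup_iff.mp a.2).1
    have hv : ∀ v w : EuclideanSpace ℝ (Fin (d + 1)), inner ℝ v w = v.ofLp ⬝ᵥ w.ofLp :=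
      fun v w => by simp [PiLp.inner_apply, dotProduct, mul_comm]
    rw [hv, hv]
    change (a.1.mulVec x.ofLp) ⬝ᵥ (a.1.mulVec y.ofLp) = _
    rw [Matrix.dotProduct_mulVec, ← Matrix.mulVec_transpose, Matrix.mulVec_mulVec, ha,
      Matrix.one_mulVec]

theorem coe_rotate (a : Rot d) (x : Sph d) : (rotate a x).1 = rotIsometry a x.1 := rfl

theorem inner_rotate_inv (a : Rot d) (x y : Sph d) :
    inner ℝ (rotate a⁻¹ x).1 y.1 = inner ℝ x.1 (rotate a y).1 := by
  have h : inner ℝ (rotate a (rotate a⁻¹ x)).1 (rotate a y).1 = inner ℝ (rotate a⁻¹ x).1 y.1 := by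
    rw [coe_rotate a, coe_rotate a, LinearIsometry.inner_map_map]
  rw [← h, ← rotate_mul, mul_inv_cancel, rotate_one]

/-- `SO(d+1)` acts transitively on the sphere: `x` is completed to an orthonormal basis, and the
sign of the last vector is adjusted. -/
theorem exists_rotate_e1_eq (hd : 2 ≤ d) (x : Sph d) : ∃ a : Rot d, rotate a (e1 d) = x := by
  have hx : ‖x.1‖ = 1 := by simp
  have hon : Orthonormal ℝ (Set.domRestrict ({0} : Set (Fin (d + 1))) (fun _ => x.1)) := by
    refine ⟨fun _ => hx, fun i j hij => absurd (Subsingleton.elim i j) hij⟩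
  obtain ⟨b, hb⟩ := hon.exists_orthonormalBasis_extension_of_card_eq (by simp)
  have hb0 : b 0 = x.1 := hb 0 rfl
  set A : Matrix (Fin (d + 1)) (Fin (d + 1)) ℝ := Matrix.of fun i j => b j i with hA
  have hAA : A.transpose * A = 1 := by
    ext i j
    have := orthonormal_iff_ite.mp b.orthonormal i j
    rw [PiLp.inner_apply] at this
    simpa [Matrix.mul_apply, hA, Matrix.one_apply, mul_comm] using this
  have hdet : A.det = 1 ∨ A.det = -1 := by
    have := congrArg Matrix.det hAA
    rw [Matrix.det_mul, Matrix.det_transpose, Matrix.det_one] at this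
    exact mul_self_eq_one_iff.mp this
  -- Multiplying the last column by `det A = ±1` makes the determinant `1` and leaves column `0`.
  set D : Matrix (Fin (d + 1)) (Fin (d + 1)) ℝ :=
    Matrix.diagonal (Function.update 1 (Fin.last d) A.det) with hD
  have hdet2 : A.det * A.det = 1 := by rcases hdet with h | h <;> simp [h]
  have hDD : D.transpose * D = 1 := by
    rw [hD, Matrix.diagonal_transpose, Matrix.diagonal_mul_diagonal, ← Matrix.diagonal_one]
    congr 1
    funext i
    rcases eq_or_ne i (Fin.last d) with rfl | hi
    · simpa using hdet2
    · simp [hi]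
  have hDdet : D.det = A.det := by
    rw [hD, Matrix.det_diagonal, Finset.prod_update_of_mem (Finset.mem_univ _)]
    simp
  have hlast : (0 : Fin (d + 1)) ≠ Fin.last d := by
    rw [Ne, Fin.ext_iff]
    simp
    omega
  refine ⟨⟨A * D, Matrix.mem_specialOrthogonalGroup_iff.mpr
    ⟨(Matrix.mem_orthogonalGroup_iff' _ _).mpr ?_, ?_⟩⟩, ?_⟩
  · change (A * D).transpose * (A * D) = 1
    rw [Matrix.transpose_mul, Matrix.mul_assoc, ← Matrix.mul_assoc A.transpose, hAA,
      Matrix.one_mul, hDD]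
  · rw [Matrix.det_mul, hDdet, hdet2]
  · refine Subtype.ext ?_
    ext i
    have : (A * D).mulVec (Pi.single 0 1) i = x.1 i := by
      rw [Matrix.mulVec_single_one, Matrix.col_apply, hD, Matrix.mul_diagonal,
        Function.update_of_ne hlast]
      simp [hA, hb0]
    simpa [rotate, e1] using this

/-- The compact group `SO(d+1)` is unimodular: a right translate of the Haar measure is again a
left-invariant probability measure. -/
theorem measurePreserving_mul_right_haarRot (g : Rot d) :
    MeasurePreserving (fun a => a * g) (haarRot d) (haarRot d) := by
  have hm : Measurable fun a : Rot d => a * g := (continuous_mul_const g).measurable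
  refine ⟨hm, ?_⟩
  have : IsProbabilityMeasure (Measure.map (fun a => a * g) (haarRot d)) :=
    Measure.isProbabilityMeasure_map hm.aemeasurable
  exact Measure.isHaarMeasure_eq_of_isProbabilityMeasure _ _

/-- The orbit map `a ↦ a e₁` carries the Haar measure to the measure on the sphere: both equal the
average of `1_s(a x)` over all `a` and `x`. -/
theorem measurePreserving_orbit (hd : 2 ≤ d) :
    MeasurePreserving (fun a : Rot d => rotate a (e1 d)) (haarRot d) (sigma d) := by
  have hm : ∀ x : Sph d, Measurable fun a : Rot d => rotate a x := fun x =>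
    (continuous_rotate.comp (Continuous.prodMk_left x)).measurable
  refine ⟨hm _, ?_⟩
  ext s hs
  rw [Measure.map_apply (hm _) hs]
  have h1 : ∀ x : Sph d, haarRot d ((fun a => rotate a x) ⁻¹' s) =
      haarRot d ((fun a => rotate a (e1 d)) ⁻¹' s) := fun x => by
    obtain ⟨g, rfl⟩ := exists_rotate_e1_eq hd x
    rw [← (measurePreserving_mul_right_haarRot g).measure_preimage
      (hm (e1 d) hs).nullMeasurableSet, ← Set.preimage_comp]
    simp only [Function.comp_def, rotate_mul]
  have h2 : ∀ a : Rot d, sigma d ((fun x => rotate a x) ⁻¹' s) = sigma d s := fun a =>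
    (measurePreserving_sphereMap (rotIsometry a)).measure_preimage hs.nullMeasurableSet
  have hS : MeasurableSet ((fun q : Rot d × Sph d => rotate q.1 q.2) ⁻¹' s) :=
    continuous_rotate.measurable hs
  have h3 := Measure.prod_apply (μ := haarRot d) (ν := sigma d) hS
  rw [Measure.prod_apply_symm hS] at h3
  simp only [← Set.preimage_comp, Function.comp_def, h1, h2, lintegral_const, measure_univ,
    mul_one] at h3
  exact h3

/-! ### The reproducing kernel of the Paley-Wiener space -/

/-- Restricted to the sphere, every polynomial of degree at most `Ω` agrees with a harmonic one,
because the factors `∑ xᵢ²` in its harmonic decomposition disappear. -/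
theorem paleyWiener_eq_map_restrictTotalDegree (d Ω : ℕ) :
    paleyWiener d Ω = (restrictTotalDegree (Fin (d + 1)) ℂ Ω).map (restrictSphere d) := by
  refine le_antisymm (Submodule.map_mono inf_le_right) ?_
  rw [Submodule.map_le_iff_le_comap]
  refine restrictTotalDegree_le_of_harmonic fun j m h hm hh hΔ => ?_
  refine ⟨h, ⟨hΔ, (mem_restrictTotalDegree _ _ _).mpr (hh.totalDegree_le.trans hm)⟩, ?_⟩
  induction j with
  | zero => simp
  | succ j ih => rw [pow_succ', mul_assoc, restrictSphere_sqNorm_mul, ih]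

theorem mem_paleyWiener_iff {Ω : ℕ} {q : Sph d → ℂ} :
    q ∈ paleyWiener d Ω ↔ ∃ p : MvPolynomial (Fin (d + 1)) ℂ,
      p.totalDegree ≤ Ω ∧ restrictSphere d p = q := by
  simp [paleyWiener_eq_map_restrictTotalDegree, Submodule.mem_map, mem_restrictTotalDegree]

theorem continuous_of_mem_paleyWiener {Ω : ℕ} {q : Sph d → ℂ} (hq : q ∈ paleyWiener d Ω) :
    Continuous q := by
  obtain ⟨p, -, rfl⟩ := mem_paleyWiener_iff.mp hq
  exact continuous_restrictSphere p

instance (d Ω : ℕ) : FiniteDimensional ℂ (paleyWiener d Ω) := by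
  rw [paleyWiener_eq_map_restrictTotalDegree]
  infer_instance

theorem eval_coords_map_conj (x : Sph d) (p : MvPolynomial (Fin (d + 1)) ℂ) :
    eval (coords x) (map (starRingEnd ℂ) p) = starRingEnd ℂ (eval (coords x) p) := by
  induction p using MvPolynomial.induction_on with
  | C a => simp
  | add p q hp hq => simp [hp, hq]
  | mul_X p i hp => simp [hp, coords]

theorem conj_mem_paleyWiener {Ω : ℕ} {q : Sph d → ℂ} (hq : q ∈ paleyWiener d Ω) :
    (fun x => starRingEnd ℂ (q x)) ∈ paleyWiener d Ω := by
  obtain ⟨p, hp, rfl⟩ := mem_paleyWiener_iff.mp hq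
  refine mem_paleyWiener_iff.mpr ⟨map (starRingEnd ℂ) p, ?_, ?_⟩
  · exact (totalDegree_le_of_support_subset (support_map_subset _ _)).trans hp
  · funext x
    exact eval_coords_map_conj x p

/-- The kernel `F_{φ_Ω}((y, x))`, as a complex number. -/
noncomputable def kernel (Ω : ℕ) (y x : Sph d) : ℂ :=
  (kernelProfile d Ω (inner ℝ y.1 x.1) : ℂ)

theorem continuous_kernel (Ω : ℕ) (y : Sph d) : Continuous (kernel Ω y) := by
  have := continuous_kernelProfile d Ω
  unfold kernel
  fun_prop

theorem kernel_comm (Ω : ℕ) (y x : Sph d) : kernel Ω y x = kernel Ω x y := by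
  rw [kernel, real_inner_comm, kernel]

theorem kernelProfile_one (d Ω : ℕ) :
    kernelProfile d Ω 1 = ∑ n ∈ Finset.range (Ω + 1), dimY d n := by
  simp [kernelProfile, Phi_one]

theorem kernel_self (Ω : ℕ) (y : Sph d) :
    kernel Ω y y = ((∑ n ∈ Finset.range (Ω + 1), dimY d n : ℝ) : ℂ) := by
  have hy : ‖y.1‖ = 1 := by simp
  rw [kernel, real_inner_self_eq_norm_sq, hy, one_pow, kernelProfile_one]

theorem restrictSphere_kernelPoly (Ω : ℕ) (y : Sph d) :
    restrictSphere d (kernelPoly Ω (coords y)) = kernel Ω y := by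
  funext x
  have h : eval (coords x) (poleVar (coords y)) = (((1 - inner ℝ y.1 x.1) / 2 : ℝ) : ℂ) := by
    have : inner ℝ y.1 x.1 = ∑ i, y.1 i * x.1 i := by simp [PiLp.inner_apply, mul_comm]
    rw [this]
    simp [poleVar, coords]
    ring
  simp [restrictSphere_apply, kernelPoly, phiPoly, kernel, kernelProfile, Phi_eq_sum, h]

theorem kernel_mem_paleyWiener (Ω : ℕ) (y : Sph d) : kernel Ω y ∈ paleyWiener d Ω :=
  mem_paleyWiener_iff.mpr ⟨_, totalDegree_kernelPoly_le _ _, restrictSphere_kernelPoly Ω y⟩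

/-- The reproducing property of the kernel on the Paley-Wiener space. -/
theorem integral_kernel_mul (hd : 2 ≤ d) {Ω : ℕ} {q : Sph d → ℂ} (hq : q ∈ paleyWiener d Ω)
    (y : Sph d) : ∫ x, kernel Ω y x * q x ∂(sigma d) = q y := by
  obtain ⟨p, hp, rfl⟩ := mem_paleyWiener_iff.mp hq
  have := (isSpherical_sphereIntegral d).map_kernelPoly_mul hd (sum_coords_sq y)
    ((mem_restrictTotalDegree _ Ω p).mpr hp)
  rw [sphereIntegral_one, one_mul, sphereIntegral_apply] at this
  rw [restrictSphere_apply, ← this, ← restrictSphere_kernelPoly]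
  simp [restrictSphere_apply]

/-- The symmetric bilinear form `(p, q) ↦ ∫ p q dσ` on the Paley-Wiener space. -/
noncomputable def sphereForm (d Ω : ℕ) : LinearMap.BilinForm ℂ (paleyWiener d Ω) :=
  LinearMap.mk₂ ℂ (fun p q => ∫ x, p.1 x * q.1 x ∂(sigma d))
    (fun p p' q => by
      simp only [Submodule.coe_add, Pi.add_apply, add_mul]
      exact integral_add
        (integrable_of_continuous ((continuous_of_mem_paleyWiener p.2).mul
          (continuous_of_mem_paleyWiener q.2)))
        (integrable_of_continuous ((continuous_of_mem_paleyWiener p'.2).mul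
          (continuous_of_mem_paleyWiener q.2))))
    (fun c p q => by
      simp only [Submodule.coe_smul, Pi.smul_apply, smul_eq_mul, mul_assoc]
      exact integral_const_mul c _)
    (fun p q q' => by
      simp only [Submodule.coe_add, Pi.add_apply, mul_add]
      exact integral_add
        (integrable_of_continuous ((continuous_of_mem_paleyWiener p.2).mul
          (continuous_of_mem_paleyWiener q.2)))
        (integrable_of_continuous ((continuous_of_mem_paleyWiener p.2).mul
          (continuous_of_mem_paleyWiener q'.2))))
    (fun c p q => by
      simp only [Submodule.coe_smul, Pi.smul_apply, smul_eq_mul, mul_left_comm _ c]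
      exact integral_const_mul c _)

theorem sphereForm_apply (d Ω : ℕ) (p q : paleyWiener d Ω) :
    sphereForm d Ω p q = ∫ x, p.1 x * q.1 x ∂(sigma d) := rfl

theorem sphereForm_comm (d Ω : ℕ) (p q : paleyWiener d Ω) :
    sphereForm d Ω p q = sphereForm d Ω q p := by
  simp only [sphereForm_apply, mul_comm]

theorem sphereForm_kernel (hd : 2 ≤ d) (Ω : ℕ) (y : Sph d) (q : paleyWiener d Ω) :
    sphereForm d Ω ⟨kernel Ω y, kernel_mem_paleyWiener Ω y⟩ q = q.1 y :=
  integral_kernel_mul hd q.2 y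

theorem sphereForm_nondegenerate (hd : 2 ≤ d) (Ω : ℕ) : (sphereForm d Ω).Nondegenerate := by
  have h : ∀ q : paleyWiener d Ω, (∀ p, sphereForm d Ω p q = 0) → q = 0 := fun q hq =>
    Subtype.ext (funext fun y => by rw [← sphereForm_kernel hd Ω y q, hq]; rfl)
  exact ⟨fun q hq => h q fun p => by rw [sphereForm_comm, hq], h⟩

/-- The kernel as the tensor of a basis of the Paley-Wiener space and its dual basis for
`∫ p q dσ`. -/
theorem exists_kernel_eq_sum (hd : 2 ≤ d) (Ω : ℕ) :
    ∃ b c : Fin (Module.finrank ℂ (paleyWiener d Ω)) → Sph d → ℂ,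
      (∀ i, b i ∈ paleyWiener d Ω) ∧ (∀ i, c i ∈ paleyWiener d Ω) ∧
      (∀ y x, kernel Ω y x = ∑ i, b i y * c i x) ∧
      ∀ i, ∫ x, b i x * c i x ∂(sigma d) = 1 := by
  have hB := sphereForm_nondegenerate hd Ω
  set b := Module.finBasis ℂ (paleyWiener d Ω)
  set c := (sphereForm d Ω).dualBasis hB b with hc
  refine ⟨fun i => (b i).1, fun i => (c i).1, fun i => (b i).2, fun i => (c i).2, ?_, ?_⟩
  · intro y x
    have h := c.sum_repr ⟨kernel Ω y, kernel_mem_paleyWiener Ω y⟩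
    simp only [hc, LinearMap.BilinForm.dualBasis_repr_apply, sphereForm_kernel hd] at h
    have h' := congrArg (fun q : paleyWiener d Ω => q.1 x) h
    simpa [Finset.sum_apply] using h'.symm
  · intro i
    have h := LinearMap.BilinForm.apply_dualBasis_left hB b i i
    rw [sphereForm_comm, if_pos rfl] at h
    exact h

/-- The dimension of the Paley-Wiener space is the trace `∫ K(x, x) dσ(x)` of its reproducing
kernel, whose diagonal is constant. -/
theorem finrank_paleyWiener (hd : 2 ≤ d) (Ω : ℕ) :
    (Module.finrank ℂ (paleyWiener d Ω) : ℝ) = ∑ n ∈ Finset.range (Ω + 1), dimY d n := by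
  obtain ⟨b, c, hb, hc, hK, h1⟩ := exists_kernel_eq_sum hd Ω
  have h : ∫ x, kernel Ω x x ∂(sigma d) = (Module.finrank ℂ (paleyWiener d Ω) : ℂ) := by
    simp only [hK]
    rw [integral_finsetSum _ fun i _ => ?_]
    · simp [h1]
    · exact integrable_of_continuous
        ((continuous_of_mem_paleyWiener (hb i)).mul (continuous_of_mem_paleyWiener (hc i)))
  simp only [kernel_self, integral_const, probReal_univ, one_smul] at h
  exact_mod_cast h.symm

theorem dimY_pos (hd : 2 ≤ d) (n : ℕ) : 0 < dimY d n := by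
  have h : (2 : ℝ) ≤ d := by exact_mod_cast hd
  have h' : (0 : ℝ) < 2 * n + d - 1 := by
    have : (0 : ℝ) ≤ n := n.cast_nonneg
    linarith
  unfold dimY
  positivity

theorem finrank_paleyWiener_strictMono (hd : 2 ≤ d) :
    StrictMono fun Ω : ℕ => Module.finrank ℂ (paleyWiener d Ω) := by
  refine strictMono_nat_of_lt_succ fun Ω => ?_
  have h : (Module.finrank ℂ (paleyWiener d Ω) : ℝ) <
      (Module.finrank ℂ (paleyWiener d (Ω + 1)) : ℝ) := by
    rw [finrank_paleyWiener hd, finrank_paleyWiener hd, Finset.sum_range_succ _ (Ω + 1)]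
    exact lt_add_of_pos_right _ (dimY_pos hd _)
  exact_mod_cast h

/-! ### Integrals of the kernel -/

theorem phi_eq_kernel (Ω : ℕ) (x : Sph d) : (phi d Ω x : ℂ) = kernel Ω (e1 d) x := by
  rw [phi, kernel, real_inner_comm]

theorem phi_e1 (d Ω : ℕ) : phi d Ω (e1 d) = ∑ n ∈ Finset.range (Ω + 1), dimY d n := by
  have h := kernel_self Ω (e1 d)
  rw [← phi_eq_kernel] at h
  exact_mod_cast h

theorem continuous_phi (d Ω : ℕ) : Continuous (phi d Ω) := by
  have := continuous_kernelProfile d Ω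
  unfold phi
  fun_prop

theorem memLp_of_continuous {E : Type*} [NormedAddCommGroup E] {f : Sph d → E}
    (hf : Continuous f) : MemLp f 2 (sigma d) :=
  hf.memLp_of_hasCompactSupport (HasCompactSupport.of_compactSpace f)

theorem integral_phi (hd : 2 ≤ d) (Ω : ℕ) : ∫ x, phi d Ω x ∂(sigma d) = 1 := by
  have h1 : (fun _ => 1 : Sph d → ℂ) ∈ paleyWiener d Ω :=
    mem_paleyWiener_iff.mpr ⟨1, by simp, by funext x; simp [restrictSphere_apply]⟩
  have h := integral_kernel_mul hd h1 (e1 d)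
  simp only [mul_one, ← phi_eq_kernel] at h
  rw [integral_complex_ofReal] at h
  exact_mod_cast h

theorem eLpNorm_phi_sq (hd : 2 ≤ d) (Ω : ℕ) :
    (eLpNorm (phi d Ω) 2 (sigma d)).toReal ^ 2 = ∑ n ∈ Finset.range (Ω + 1), dimY d n := by
  have h := integral_kernel_mul hd (kernel_mem_paleyWiener Ω (e1 d)) (e1 d)
  rw [kernel_self] at h
  simp only [← phi_eq_kernel, ← Complex.ofReal_mul] at h
  rw [integral_complex_ofReal] at h
  have h' : ∫ x, phi d Ω x * phi d Ω x ∂(sigma d) = ∑ n ∈ Finset.range (Ω + 1), dimY d n := by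
    exact_mod_cast h
  rw [← h', (memLp_of_continuous (continuous_phi d Ω)).eLpNorm_eq_integral_rpow_norm
    two_ne_zero ENNReal.ofNat_ne_top, ENNReal.toReal_ofReal (by positivity)]
  simp only [ENNReal.toReal_ofNat, Real.rpow_two, Real.norm_eq_abs, sq_abs]
  rw [← Real.rpow_natCast, ← Real.rpow_mul (by positivity)]
  simp [sq]

/-! ### Convolution with the kernel as a projection -/

/-- The integral operator with kernel `F_{φ_Ω}((y, x))`. -/
noncomputable def kernelOp (Ω : ℕ) (f : Sph d → ℂ) (y : Sph d) : ℂ :=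
  ∫ x, f x * kernel Ω y x ∂(sigma d)

theorem integrable_mul_of_continuous {f g : Sph d → ℂ} (hf : MemLp f 2 (sigma d))
    (hg : Continuous g) : Integrable (fun x => f x * g x) (sigma d) :=
  hf.integrable_mul (memLp_of_continuous hg)

/-- The integrand of the convolution factors through the orbit map `a ↦ a e₁`, because
`(a⁻¹ y, e₁) = (y, a e₁)`. -/
theorem conv_integrand_eq (f : Sph d → ℂ) (Ω : ℕ) (y : Sph d) (a : Rot d) :
    f (rotate a (e1 d)) * (phi d Ω (rotate a⁻¹ y) : ℂ) =
      (fun x => f x * kernel Ω y x) (rotate a (e1 d)) := by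
  simp only [phi, kernel, inner_rotate_inv]

theorem integrable_conv_integrand (hd : 2 ≤ d) {f : Sph d → ℂ} (hf : MemLp f 2 (sigma d))
    (Ω : ℕ) (y : Sph d) :
    Integrable (fun a : Rot d => f (rotate a (e1 d)) * (phi d Ω (rotate a⁻¹ y) : ℂ))
      (haarRot d) := by
  have hmp := measurePreserving_orbit hd
  have hint := integrable_mul_of_continuous hf (continuous_kernel Ω y)
  have h := hmp.integrable_comp_of_integrable hint
  rw [funext (conv_integrand_eq f Ω y)]
  exact h

theorem conv_phi_eq_kernelOp (hd : 2 ≤ d) {f : Sph d → ℂ} (hf : MemLp f 2 (sigma d)) (Ω : ℕ)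
    (y : Sph d) : conv f (fun x => (phi d Ω x : ℂ)) y = kernelOp Ω f y := by
  have hmp := measurePreserving_orbit hd
  have hint := integrable_mul_of_continuous hf (continuous_kernel Ω y)
  rw [conv, kernelOp, ← hmp.map_eq, integral_map hmp.measurable.aemeasurable
    (by rw [hmp.map_eq]; exact hint.aestronglyMeasurable)]
  exact integral_congr_ae (ae_of_all _ (conv_integrand_eq f Ω y))

/-- The kernel operator takes values in the Paley-Wiener space, and `f` minus its image is
orthogonal to that space for the bilinear pairing `∫ p q dσ`. -/
theorem kernelOp_mem_and_integral (hd : 2 ≤ d) {f : Sph d → ℂ} (hf : MemLp f 2 (sigma d))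
    (Ω : ℕ) : kernelOp Ω f ∈ paleyWiener d Ω ∧ ∀ q ∈ paleyWiener d Ω,
      ∫ x, kernelOp Ω f x * q x ∂(sigma d) = ∫ x, f x * q x ∂(sigma d) := by
  obtain ⟨b, c, hb, hc, hK, -⟩ := exists_kernel_eq_sum hd Ω
  have hP : ∀ y, kernelOp Ω f y = ∑ i, (∫ x, f x * c i x ∂(sigma d)) * b i y := fun y => by
    rw [kernelOp]
    simp only [hK, Finset.mul_sum]
    rw [integral_finsetSum _ fun i _ => ?_]
    · refine Finset.sum_congr rfl fun i _ => ?_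
      rw [← integral_mul_const]
      congr 1
      funext x
      ring
    · exact integrable_mul_of_continuous hf
        (continuous_const.mul (continuous_of_mem_paleyWiener (hc i)))
  refine ⟨?_, fun q hq => ?_⟩
  · have : kernelOp Ω f = ∑ i, (∫ x, f x * c i x ∂(sigma d)) • b i := by
      funext y
      simp [hP, Finset.sum_apply]
    rw [this]
    exact Submodule.sum_mem _ fun i _ => Submodule.smul_mem _ _ (hb i)
  · have hq' : ∀ x, q x = ∑ i, c i x * ∫ y, b i y * q y ∂(sigma d) := fun x => by
      rw [← integral_kernel_mul hd hq x]
      simp only [kernel_comm Ω x, hK, Finset.sum_mul]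
      rw [integral_finsetSum _ fun i _ => ?_]
      · refine Finset.sum_congr rfl fun i _ => ?_
        rw [← integral_const_mul]
        congr 1
        funext x
        ring
      · exact integrable_of_continuous (((continuous_of_mem_paleyWiener (hb i)).mul
          continuous_const).mul (continuous_of_mem_paleyWiener hq))
    have e1 : ∫ x, f x * q x ∂(sigma d) =
        ∑ i, (∫ x, f x * c i x ∂(sigma d)) * ∫ y, b i y * q y ∂(sigma d) := by
      conv_lhs => enter [2, x]; rw [hq' x, Finset.mul_sum]
      rw [integral_finsetSum _ fun i _ => ?_]
      · simp only [← mul_assoc, integral_mul_const]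
      · exact integrable_mul_of_continuous hf
          ((continuous_of_mem_paleyWiener (hc i)).mul continuous_const)
    rw [e1]
    simp only [hP, Finset.sum_mul, mul_assoc]
    rw [integral_finsetSum _ fun i _ => ?_]
    · simp only [integral_const_mul]
    · exact integrable_of_continuous (continuous_const.mul
        ((continuous_of_mem_paleyWiener (hb i)).mul (continuous_of_mem_paleyWiener hq)))

/-- Since `f - f * φ_Ω` is orthogonal to the Paley-Wiener space, which is closed under complex
conjugation, `f * φ_Ω` is the best approximation of `f` from that space. -/
theorem eLpNorm_kernelOp_sub_le (hd : 2 ≤ d) {f : Sph d → ℂ} (hf : MemLp f 2 (sigma d)) {Ω : ℕ}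
    {q : Sph d → ℂ} (hq : q ∈ paleyWiener d Ω) :
    eLpNorm (fun y => kernelOp Ω f y - f y) 2 (sigma d) ≤
      eLpNorm (fun y => q y - f y) 2 (sigma d) := by
  obtain ⟨hP, horth⟩ := kernelOp_mem_and_integral hd hf Ω
  have hPL := memLp_of_continuous (continuous_of_mem_paleyWiener hP)
  have hqL := memLp_of_continuous (continuous_of_mem_paleyWiener hq)
  have h1 : MemLp (fun y => kernelOp Ω f y - f y) 2 (sigma d) := hPL.sub hf
  have h2 : MemLp (fun y => q y - kernelOp Ω f y) 2 (sigma d) := hqL.sub hPL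
  have h3 : MemLp (fun y => q y - f y) 2 (sigma d) := hqL.sub hf
  have hinner : inner ℂ (h2.toLp _) (h1.toLp _) = 0 := by
    rw [L2.inner_def]
    have hc := conj_mem_paleyWiener (Submodule.sub_mem _ hq hP)
    have e : ∀ᵐ x ∂(sigma d), inner ℂ (h2.toLp _ x) (h1.toLp _ x) =
        kernelOp Ω f x * starRingEnd ℂ ((q - kernelOp Ω f) x) -
          f x * starRingEnd ℂ ((q - kernelOp Ω f) x) := by
      filter_upwards [h2.coeFn_toLp, h1.coeFn_toLp] with x hx2 hx1
      rw [hx2, hx1, RCLike.inner_apply, Pi.sub_apply]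
      ring
    rw [integral_congr_ae e, integral_sub
      (integrable_mul_of_continuous hPL (continuous_of_mem_paleyWiener hc))
      (integrable_mul_of_continuous hf (continuous_of_mem_paleyWiener hc)), horth _ hc, sub_self]
  have hsum : h3.toLp _ = h2.toLp _ + h1.toLp _ := by
    rw [← MemLp.toLp_add]
    congr 1
    funext x
    simp
  have hnorm : ‖h1.toLp _‖ ≤ ‖h3.toLp _‖ := by
    rw [hsum]
    have := norm_add_mul_self (𝕜 := ℂ) (h2.toLp _) (h1.toLp _)
    rw [hinner, map_zero] at this
    nlinarith [norm_nonneg (h2.toLp _ + h1.toLp _), norm_nonneg (h1.toLp _),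
      norm_nonneg (h2.toLp _)]
  rw [Lp.norm_toLp, Lp.norm_toLp] at hnorm
  exact (ENNReal.toReal_le_toReal h1.2.ne h3.2.ne).mp hnorm

/-! ### Density of the polynomials -/

/-- The restrictions of polynomials to the sphere, as a star subalgebra of the continuous
functions. -/
noncomputable def polySubalgebra (d : ℕ) : StarSubalgebra ℂ C(Sph d, ℂ) where
  carrier := {g | ∃ p, ∀ x, g x = restrictSphere d p x}
  mul_mem' := by
    rintro f g ⟨p, hp⟩ ⟨q, hq⟩
    exact ⟨p * q, fun x => by simp [hp, hq, restrictSphere_apply]⟩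
  add_mem' := by
    rintro f g ⟨p, hp⟩ ⟨q, hq⟩
    exact ⟨p + q, fun x => by simp [hp, hq]⟩
  algebraMap_mem' r := ⟨C r, fun x => by simp [restrictSphere_apply]⟩
  star_mem' := by
    rintro f ⟨p, hp⟩
    exact ⟨map (starRingEnd ℂ) p, fun x => by
      rw [restrictSphere_apply, eval_coords_map_conj, ← restrictSphere_apply, ← hp]
      rfl⟩

theorem polySubalgebra_separatesPoints (d : ℕ) : (polySubalgebra d).SeparatesPoints := by
  intro x y hxy
  obtain ⟨i, hi⟩ : ∃ i, x.1 i ≠ y.1 i := by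
    by_contra! h
    exact hxy (Subtype.ext (by ext i; exact h i))
  refine ⟨_, ⟨⟨restrictSphere d (X i), continuous_restrictSphere _⟩,
    ⟨X i, fun _ => rfl⟩, rfl⟩, ?_⟩
  simpa [restrictSphere_apply, coords] using hi

/-- Continuous functions are dense in `L²`, and polynomials are uniformly dense among them. -/
theorem exists_eLpNorm_restrictSphere_sub_le {f : Sph d → ℂ} (hf : MemLp f 2 (sigma d))
    {ε : ℝ≥0∞} (hε : ε ≠ 0) :
    ∃ p : MvPolynomial (Fin (d + 1)) ℂ,
      eLpNorm (fun y => restrictSphere d p y - f y) 2 (sigma d) ≤ ε := by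
  obtain ⟨δ, hδ, hδε⟩ := ENNReal.lt_iff_exists_nnreal_btwn.mp
    (ENNReal.half_pos hε)
  have hδ0 : (0 : ℝ) < δ := by exact_mod_cast hδ
  obtain ⟨g, -, hg, hgc, -⟩ := hf.exists_hasCompactSupport_eLpNorm_sub_le (by simp)
    (ENNReal.half_pos hε).ne'
  have htop := ContinuousMap.starSubalgebra_topologicalClosure_eq_top_of_separatesPoints
    (polySubalgebra d) (polySubalgebra_separatesPoints d)
  have hmem : (⟨g, hgc⟩ : C(Sph d, ℂ)) ∈ (polySubalgebra d).topologicalClosure := by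
    rw [htop]; trivial
  obtain ⟨h, ⟨p, hp⟩, hh⟩ := Metric.mem_closure_iff.mp hmem δ hδ0
  refine ⟨p, ?_⟩
  have hbound : eLpNorm (restrictSphere d p - g) 2 (sigma d) ≤ ε / 2 := by
    have h1 : ∀ x, ‖(restrictSphere d p - g) x‖ ≤ δ := fun x => by
      have := (ContinuousMap.dist_apply_le_dist x).trans hh.le
      rw [dist_comm, dist_eq_norm, hp] at this
      exact this
    refine (eLpNorm_le_of_ae_bound (ae_of_all _ h1)).trans ?_
    simpa using hδε.le
  have hsplit : (fun y => restrictSphere d p y - f y) =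
      (restrictSphere d p - g) + (g - f) := by
    funext y
    simp
  rw [hsplit, ← ENNReal.add_halves ε]
  refine (eLpNorm_add_le ?_ ?_ (by norm_num)).trans (add_le_add hbound ?_)
  · exact ((continuous_restrictSphere p).sub hgc).aestronglyMeasurable
  · exact hgc.aestronglyMeasurable.sub hf.1
  · rwa [eLpNorm_sub_comm]

theorem tendsto_eLpNorm_kernelOp_sub (hd : 2 ≤ d) {f : Sph d → ℂ} (hf : MemLp f 2 (sigma d)) :
    Tendsto (fun Ω : ℕ => eLpNorm (fun y => kernelOp Ω f y - f y) 2 (sigma d)) atTop (𝓝 0) := by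
  rw [ENNReal.tendsto_nhds_zero]
  intro ε hε
  obtain ⟨p, hp⟩ := exists_eLpNorm_restrictSphere_sub_le hf hε.ne'
  filter_upwards [eventually_ge_atTop p.totalDegree] with Ω hΩ
  exact (eLpNorm_kernelOp_sub_le hd hf (mem_paleyWiener_iff.mpr ⟨p, hΩ, rfl⟩)).trans hp

end SphereKernel

theorem mainTheorem10 (d : ℕ) (hd : 2 ≤ d) :
    -- `φ_Ω(e₁) = ∑_{n ≤ Ω} d(n) = dim L²_Ω(S^d)`, which increases to infinity
    (∀ Ω : ℕ, phi d Ω (e1 d) = ∑ n ∈ Finset.range (Ω + 1), dimY d n ∧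
      ∑ n ∈ Finset.range (Ω + 1), dimY d n = (Module.finrank ℂ (paleyWiener d Ω) : ℝ)) ∧
    StrictMono (fun Ω : ℕ => Module.finrank ℂ (paleyWiener d Ω)) ∧
    Tendsto (fun Ω : ℕ => Module.finrank ℂ (paleyWiener d Ω)) atTop atTop ∧
    -- `∫ φ_Ω dσ = 1`
    (∀ Ω : ℕ, Integrable (phi d Ω) (sigma d) ∧ ∫ x, phi d Ω x ∂(sigma d) = 1) ∧
    -- `‖φ_Ω‖₂² = ∑_{n ≤ Ω} d(n) → ∞`
    (∀ Ω : ℕ, MemLp (phi d Ω) 2 (sigma d) ∧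
      (eLpNorm (phi d Ω) 2 (sigma d)).toReal ^ 2 = ∑ n ∈ Finset.range (Ω + 1), dimY d n) ∧
    Tendsto (fun Ω : ℕ => (eLpNorm (phi d Ω) 2 (sigma d)).toReal ^ 2) atTop atTop ∧
    -- `f * φ_Ω = ∫ f(x) F_{φ_Ω}((·, x)) dσ(x) → f` in `L²`
    (∀ f : Sph d → ℂ, MemLp f 2 (sigma d) →
      (∀ (Ω : ℕ) (y : Sph d),
        Integrable (fun a : Rot d =>
          f (rotate a (e1 d)) * (phi d Ω (rotate a⁻¹ y) : ℂ)) (haarRot d) ∧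
        Integrable (fun x : Sph d => f x * (kernelProfile d Ω (inner ℝ y.1 x.1) : ℂ)) (sigma d) ∧
        conv f (fun x => (phi d Ω x : ℂ)) y =
          ∫ x, f x * (kernelProfile d Ω (inner ℝ y.1 x.1) : ℂ) ∂(sigma d)) ∧
      (∀ Ω : ℕ, MemLp (conv f (fun x => (phi d Ω x : ℂ))) 2 (sigma d)) ∧
      Tendsto
        (fun Ω : ℕ => eLpNorm (fun y => conv f (fun x => (phi d Ω x : ℂ)) y - f y) 2 (sigma d))
        atTop (𝓝 0)) := by
  have hmono := finrank_paleyWiener_strictMono hd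
  refine ⟨fun Ω => ⟨phi_e1 d Ω, (finrank_paleyWiener hd Ω).symm⟩, hmono, hmono.tendsto_atTop,
    fun Ω => ⟨integrable_of_continuous (continuous_phi d Ω), integral_phi hd Ω⟩,
    fun Ω => ⟨memLp_of_continuous (continuous_phi d Ω), eLpNorm_phi_sq hd Ω⟩, ?_,
    fun f hf => ⟨fun Ω y => ⟨?_, integrable_mul_of_continuous hf (continuous_kernel Ω y),
      conv_phi_eq_kernelOp hd hf Ω y⟩, fun Ω => ?_, ?_⟩⟩
  · simp only [eLpNorm_phi_sq hd, ← finrank_paleyWiener hd]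
    exact tendsto_natCast_atTop_atTop.comp hmono.tendsto_atTop
  · exact integrable_conv_integrand hd hf Ω y
  · rw [funext (conv_phi_eq_kernelOp hd hf Ω)]
    exact memLp_of_continuous
      (continuous_of_mem_paleyWiener (kernelOp_mem_and_integral hd hf Ω).1)
  · simp only [conv_phi_eq_kernelOp hd hf]
    exact tendsto_eLpNorm_kernelOp_sub hd hf
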